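/- Consider the problem of minimizing $f(x)$ over $x\in\mathbb R^n$ subject to $c_i(x)=0$ for $i\in\mathcal E$ and $c_i(x)\ge 0$ for $i\in\mathcal I$, where $\mathcal E,\mathcal I$ are finite, all $c_i$ are affine, and the feasible region $\Omega$ is nonempty. A point $\bar x$ is a KKT point if it is feasible and there is $\bar\lambda$ with $0\in\bar\partial f(\bar x)-\sum_{i\in\mathcal E\cup\mathcal I}\bar\lambda_i\nabla c_i(\bar x)$, $\bar\lambda_i c_i(\bar x)=0$ and $\bar\lambda_i\ge 0$ for $i\in\mathcal I$, where $\bar\partial f$ is the Clarke subdifferential. Let $D\supseteq\Omega$ be compact and convex, let $f$ be Lipschitz on $D$ and upper-$C^2$ on an open set containing $D$ (locally $f(x)=\min_{t\in T}p(t,x)$ with $T$ compact and $p$ and its $x$-derivatives up to order two jointly continuous), and let $\rho>0$ be such that $-f+\tfrac{\rho}{2}\|\cdot\|^2$ is convex on $D$. Write $v(x)=\sum_{i\in\mathcal E}|c_i(x)|+\sum_{i\in\mathcal I}\max\{0,-c_i(x)\}$ and $\phi(x,\theta)=f(x)+\theta v(x)$. Fix $\eta,\tau\in(0,1)$, $\gamma>0$,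 $\theta_0>0$, $x_0\in D$. For $k=0,1,2,\dots$ the algorithm picks $g_k\in\bar\partial f(x_k)$ and a symmetric matrix $B_k$; takes a solution $(d_k,v^k,w^k,t^k)$ of $$\min_{d,v,w,t}\ f(x_k)+g_k^Td+\tfrac12 d^TB_kd+\theta_k\sum_{i\in\mathcal E}(v_i+w_i)+\theta_k\sum_{i\in\mathcal I}t_i$$ subject to $c_i(x_k)+\nabla c_i(x_k)^Td=v_i-w_i$ $(i\in\mathcal E)$, $c_i(x_k)+\nabla c_i(x_k)^Td\ge -t_i$ $(i\in\mathcal I)$, $v,w,t\ge0$, with a Lagrange multiplier vector $\lambda^{k+1}$ of the first two groups of constraints; sets $\theta_{k+1}=\max\{\theta_k,\|\lambda^{k+1}\|_\infty+\gamma\}$; takes as $\alpha_k$ the first of the numbers $1,\tau,\tau^2,\dots$ with $\phi(x_k,\theta_k)-\phi(x_k+\alpha_kd_k,\theta_k)\ge\eta\alpha_k\tfrac12d_k^TB_kd_k$; and sets $x_{k+1}=x_k+\alpha_kd_k$. (If $d_k=0$ and $v(x_k)=0$ the algorithm may stop; the sequence is then continued by repeating $x_k$.) Assume that $x_k+d_k\in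 D$ for all $k$, that $\{B_k\}$ is bounded, and that there is $b>0$ with $d^TB_kd\ge b\|d\|^2$ for all $k$ and $d$. Assume MFCQ at every accumulation point $\bar x$ of $\{x_k\}$: the gradients $\nabla c_i(\bar x)$, $i\in\mathcal E$, are linearly independent, and some $u$ satisfies $\nabla c_i(\bar x)^Tu=0$ for $i\in\mathcal E$ and $\nabla c_i(\bar x)^Tu>0$ for all $i\in\mathcal I$ with $c_i(\bar x)=0$. For constants $\sigma$ and $l>0$ let $F=-f+\tfrac{\sigma}{2}\|\cdot\|^2$ on $D$ and $F=+\infty$ off $D$, let $F^*(y)=\sup_x\{\langle y,x\rangle-F(x)\}$, and define the potential function $$L(x,y,w)=-y^Tx+F^*(y)+\tfrac{\sigma}{2}\|x\|^2+\tfrac{l}{2}\|x-w\|^2+i_{\bar C}(x,w),$$ where $i_{\bar C}$ is the $0/{+\infty}$ indicator function of the set $\bar C$ of all $(x,w)$ with $c_i(w)+\nabla c_i(w)^T(x-w)=0$ for $i\in\mathcal E$ and $\ge0$ for $i\in\mathcal I$. Assume that $L$ is a KL function, i.e. with $\partial L$ the general (limiting) subdifferential, at each $\hat z$ with $\partial L(\hat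 z)\ne\emptyset$ there are $\bar\eta\in(0,\infty]$, a neighborhood $U$ of $\hat z$ and a continuous concave $\varphi:[0,\bar\eta)\to[0,\infty)$ with $\varphi(0)=0$, $\varphi\in C^1(0,\bar\eta)$, $\varphi'>0$ on $(0,\bar\eta)$, and $\varphi'(L(z)-L(\hat z))\,\mathrm{dist}(0,\partial L(z))\ge1$ whenever $z\in U$ and $L(\hat z)<L(z)<L(\hat z)+\bar\eta$. If $b\ge\sigma\ge\rho$ and $2b\ge\sigma+l$, then the whole sequence $\{x_k\}$ converges, and its limit is a KKT point. -/

import Mathlib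

open Filter Topology

/-! ## Subdifferentials -/

section Subdifferentials

variable {V : Type*} [NormedAddCommGroup V] [InnerProductSpace ℝ V]

/-- The lower regular subdifferential of an extended-real-valued function at a point where it is
finite: `f y ≥ f x + ⟪g, y - x⟫ + o(‖y - x‖)`, that is,
`liminf_{y → x, y ≠ x} (f y - f x - ⟪g, y - x⟫) / ‖y - x‖ ≥ 0`. -/
def regularSubdiff (f : V → EReal) (x : V) : Set V :=
  {g | f x ≠ ⊤ ∧ f x ≠ ⊥ ∧ ∀ ε : ℝ, 0 < ε → ∀ᶠ y in 𝓝 x,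
    f x + ((inner ℝ g (y - x) - ε * ‖y - x‖ : ℝ) : EReal) ≤ f y}

/-- The lower general (limiting) subdifferential of an extended-real-valued function:
limits of regular subgradients at points `u ν → x` with `f (u ν) → f x`. -/
def generalSubdiff (f : V → EReal) (x : V) : Set V :=
  {g | f x ≠ ⊤ ∧ f x ≠ ⊥ ∧ ∃ u h : ℕ → V,
    Tendsto u atTop (𝓝 x) ∧ Tendsto (fun ν => f (u ν)) atTop (𝓝 (f x)) ∧
    (∀ ν, h ν ∈ regularSubdiff f (u ν)) ∧ Tendsto h atTop (𝓝 g)}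

/-- The Clarke generalized directional derivative
`limsup_{y → x, s ↓ 0} (f (y + s v) - f y) / s`, as an extended real number. -/
noncomputable def clarkeDeriv (f : V → ℝ) (x v : V) : EReal :=
  limsup (fun q : V × ℝ => (((f (q.1 + q.2 • v) - f q.1) / q.2 : ℝ) : EReal)) (𝓝 x ×ˢ 𝓝[>] 0)

/-- The Clarke subdifferential. -/
def clarkeSubdiff (f : V → ℝ) (x : V) : Set V :=
  {g | ∀ v, ((inner ℝ g v : ℝ) : EReal) ≤ clarkeDeriv f x v}

/-- The Kurdyka-Łojasiewicz property at `x₀`. The distance is extended-valued, so that the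
distance to an empty subdifferential is `∞`. -/
def HasKLAt (f : V → EReal) (x₀ : V) : Prop :=
  ∃ (η : EReal) (U : Set V) (φ : ℝ → ℝ), 0 < η ∧ U ∈ 𝓝 x₀ ∧
    ContinuousOn φ {s : ℝ | 0 ≤ s ∧ (s : EReal) < η} ∧
    ConcaveOn ℝ {s : ℝ | 0 ≤ s ∧ (s : EReal) < η} φ ∧
    (∀ s : ℝ, 0 ≤ s → (s : EReal) < η → 0 ≤ φ s) ∧
    φ 0 = 0 ∧
    ContDiffOn ℝ 1 φ {s : ℝ | 0 < s ∧ (s : EReal) < η} ∧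
    (∀ s : ℝ, 0 < s → (s : EReal) < η → 0 < deriv φ s) ∧
    ∀ x ∈ U, f x₀ < f x → f x < f x₀ + η →
      1 ≤ ENNReal.ofReal (deriv φ ((f x).toReal - (f x₀).toReal)) *
        Metric.infEDist 0 (generalSubdiff f x)

/-- A KL function: the KL property holds at each point of the domain of the general
subdifferential. -/
def IsKLFunction (f : V → EReal) : Prop :=
  ∀ x, (generalSubdiff f x).Nonempty → HasKLAt f x

/-- The conjugate function `u ↦ sup_x (⟪u, x⟫ - F x)`. -/
noncomputable def conjugateFun (F : V → EReal) (u : V) : EReal :=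
  ⨆ x, ((inner ℝ u x : ℝ) : EReal) - F x

open Classical in
/-- The indicator function of a set: `0` on the set and `+∞` off it. -/
noncomputable def indicatorFun {α : Type*} (C : Set α) (a : α) : EReal :=
  if a ∈ C then 0 else ⊤

/-- `f` is upper-`C²` on `O`: near each point of `O` it is a minimum `min_{t ∈ T} p t x` over a
compact space `T` of functions that are `C²` in `x` and whose derivatives in `x` of orders
`0, 1, 2` are jointly continuous in `(t, x)`. -/
def IsUpperC2On (f : V → ℝ) (O : Set V) : Prop :=
  ∀ x₀ ∈ O, ∃ (W : Set V) (T : Type) (_ : TopologicalSpace T) (_ : CompactSpace T)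
    (p : T → V → ℝ), IsOpen W ∧ x₀ ∈ W ∧
      (∀ t, ContDiffOn ℝ 2 (p t) W) ∧
      (∀ j : ℕ, j ≤ 2 →
        ContinuousOn (fun q : T × V => iteratedFDeriv ℝ j (p q.1) q.2) (Set.univ ×ˢ W)) ∧
      ∀ x ∈ W, IsLeast (Set.range fun t => p t x) (f x)

end Subdifferentials

/-! ## The constrained problem -/

/-- Data of the problem: minimize `f x` subject to `c (inl i) x = 0` (equality constraints)
and `c (inr i) x ≥ 0` (inequality constraints). -/
structure NLP (n me mi : ℕ) where
  /-- the objective -/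
  f : EuclideanSpace ℝ (Fin n) → ℝ
  /-- the constraint functions, equalities on the left, inequalities on the right -/
  c : Fin me ⊕ Fin mi → EuclideanSpace ℝ (Fin n) → ℝ

namespace NLP

variable {n me mi : ℕ} (P : NLP n me mi)

/-- The feasible region. -/
def feasible : Set (EuclideanSpace ℝ (Fin n)) :=
  {x | (∀ i, P.c (Sum.inl i) x = 0) ∧ ∀ i, 0 ≤ P.c (Sum.inr i) x}

/-- The linearization `c_i(x) + ∇c_i(x)ᵀ d`. -/
noncomputable def lin (i : Fin me ⊕ Fin mi) (x d : EuclideanSpace ℝ (Fin n)) : ℝ :=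
  P.c i x + inner ℝ (gradient (P.c i) x) d

/-- The constraint violation `∑_{i ∈ E} |c_i(x)| + ∑_{i ∈ I} max{0, -c_i(x)}`. -/
def violation (x : EuclideanSpace ℝ (Fin n)) : ℝ :=
  ∑ i, |P.c (Sum.inl i) x| + ∑ i, max 0 (-P.c (Sum.inr i) x)

/-- The `ℓ₁` merit function. -/
def merit (x : EuclideanSpace ℝ (Fin n)) (θ : ℝ) : ℝ := P.f x + θ * P.violation x

/-- KKT points, in terms of the Clarke subdifferential of the objective. -/
def IsKKT (x : EuclideanSpace ℝ (Fin n)) : Prop :=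
  ∃ lam : Fin me ⊕ Fin mi → ℝ,
    (∃ g ∈ clarkeSubdiff P.f x, g - ∑ i, lam i • gradient (P.c i) x = 0) ∧
    (∀ i, P.c (Sum.inl i) x = 0) ∧
    (∀ i, lam (Sum.inr i) * P.c (Sum.inr i) x = 0) ∧
    (∀ i, 0 ≤ P.c (Sum.inr i) x) ∧
    (∀ i, 0 ≤ lam (Sum.inr i))

/-- The Mangasarian-Fromovitz constraint qualification at `x`. -/
def MFCQ (x : EuclideanSpace ℝ (Fin n)) : Prop :=
  LinearIndependent ℝ (fun i : Fin me => gradient (P.c (Sum.inl i)) x) ∧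
  ∃ w : EuclideanSpace ℝ (Fin n),
    (∀ i, P.c (Sum.inr i) x = 0 → 0 < inner ℝ (gradient (P.c (Sum.inr i)) x) w) ∧
    ∀ i, inner ℝ (gradient (P.c (Sum.inl i)) x) w = 0

/-- All constraint functions are affine. -/
def AffineConstraints : Prop :=
  ∀ i, ∃ (a : EuclideanSpace ℝ (Fin n)) (β : ℝ), ∀ x, P.c i x = inner ℝ a x + β

/-! ### The relaxed quadratic subproblem at the point `x`
The variables are the step `d` and the slacks `v`, `w` (equalities), `t` (inequalities). -/

/-- The feasible region of the relaxed subproblem. -/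
def SubFeasible (x d : EuclideanSpace ℝ (Fin n)) (v w : Fin me → ℝ) (t : Fin mi → ℝ) : Prop :=
  (∀ i, P.lin (Sum.inl i) x d = v i - w i) ∧ (∀ i, -t i ≤ P.lin (Sum.inr i) x d) ∧
  (∀ i, 0 ≤ v i) ∧ (∀ i, 0 ≤ w i) ∧ ∀ i, 0 ≤ t i

/-- The objective of the relaxed subproblem. -/
noncomputable def subObjective (x g : EuclideanSpace ℝ (Fin n))
    (B : EuclideanSpace ℝ (Fin n) →L[ℝ] EuclideanSpace ℝ (Fin n)) (θ : ℝ)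
    (d : EuclideanSpace ℝ (Fin n)) (v w : Fin me → ℝ) (t : Fin mi → ℝ) : ℝ :=
  P.f x + inner ℝ g d + 1 / 2 * inner ℝ d (B d) + θ * ∑ i, (v i + w i) + θ * ∑ i, t i

/-- `(d, v, w, t)` solves the relaxed subproblem. -/
def IsSubSolution (x g : EuclideanSpace ℝ (Fin n))
    (B : EuclideanSpace ℝ (Fin n) →L[ℝ] EuclideanSpace ℝ (Fin n)) (θ : ℝ)
    (d : EuclideanSpace ℝ (Fin n)) (v w : Fin me → ℝ) (t : Fin mi → ℝ) : Prop :=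
  P.SubFeasible x d v w t ∧ ∀ d' v' w' t', P.SubFeasible x d' v' w' t' →
    P.subObjective x g B θ d v w t ≤ P.subObjective x g B θ d' v' w' t'

/-- `lam` is a Lagrange multiplier vector of the linearized constraints at `(d, v, w, t)`:
together with multipliers `p`, `q`, `r` of the bounds on `v`, `w`, `t` it satisfies the
first-order optimality conditions of the relaxed subproblem. -/
def IsSubMultiplier (x g : EuclideanSpace ℝ (Fin n))
    (B : EuclideanSpace ℝ (Fin n) →L[ℝ] EuclideanSpace ℝ (Fin n)) (θ : ℝ)
    (d : EuclideanSpace ℝ (Fin n)) (v w : Fin me → ℝ) (t : Fin mi → ℝ)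
    (lam : Fin me ⊕ Fin mi → ℝ) : Prop :=
  g + B d - ∑ i, lam i • gradient (P.c i) x = 0 ∧
  P.SubFeasible x d v w t ∧
  (∀ i, lam (Sum.inr i) * (P.lin (Sum.inr i) x d + t i) = 0) ∧
  (∀ i, 0 ≤ lam (Sum.inr i)) ∧
  ∃ (p q : Fin me → ℝ) (r : Fin mi → ℝ),
    (∀ i, θ + lam (Sum.inl i) - p i = 0) ∧ (∀ i, θ - lam (Sum.inl i) - q i = 0) ∧
    (∀ i, θ - lam (Sum.inr i) - r i = 0) ∧
    (∀ i, p i * v i = 0) ∧ (∀ i, q i * w i = 0) ∧ (∀ i, r i * t i = 0) ∧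
    (∀ i, 0 ≤ p i) ∧ (∀ i, 0 ≤ q i) ∧ ∀ i, 0 ≤ r i

/-- The line search condition for the step size `α` at `x` in direction `d`. -/
def LineSearchOK (η : ℝ) (x d : EuclideanSpace ℝ (Fin n))
    (B : EuclideanSpace ℝ (Fin n) →L[ℝ] EuclideanSpace ℝ (Fin n)) (θ α : ℝ) : Prop :=
  η * α * (1 / 2) * inner ℝ d (B d) ≤ P.merit x θ - P.merit (x + α • d) θ

/-- An infinite run of the nonsmooth line search SQP method with parameters `η`, `τ`, `γ`.
The matrices `B k` are arbitrary symmetric ones, since the method leaves their update open.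
The stopping test (with zero tolerances: `d k = 0` and zero violation at `x k`) need not fail
in a run; a run that stops at `x k` is extended by repeating its last iterate and its data. -/
structure SQPRun (η τ γ : ℝ) where
  /-- iterates -/
  x : ℕ → EuclideanSpace ℝ (Fin n)
  /-- subgradients of the objective -/
  g : ℕ → EuclideanSpace ℝ (Fin n)
  /-- symmetric matrices of the quadratic models -/
  B : ℕ → EuclideanSpace ℝ (Fin n) →L[ℝ] EuclideanSpace ℝ (Fin n)
  /-- penalty parameters -/
  θ : ℕ → ℝ
  /-- search directions -/
  d : ℕ → EuclideanSpace ℝ (Fin n)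
  /-- slacks of the subproblems -/
  v : ℕ → Fin me → ℝ
  /-- slacks of the subproblems -/
  w : ℕ → Fin me → ℝ
  /-- slacks of the subproblems -/
  t : ℕ → Fin mi → ℝ
  /-- Lagrange multipliers of the subproblems; `lam (k + 1)` belongs to iteration `k` -/
  lam : ℕ → Fin me ⊕ Fin mi → ℝ
  /-- step sizes -/
  α : ℕ → ℝ
  θ_zero_pos : 0 < θ 0
  B_symm : ∀ k y z, inner ℝ (B k y) z = inner ℝ y (B k z)
  subgrad : ∀ k, g k ∈ clarkeSubdiff P.f (x k)
  solves : ∀ k, P.IsSubSolution (x k) (g k) (B k) (θ k) (d k) (v k) (w k) (t k)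
  multiplier : ∀ k,
    P.IsSubMultiplier (x k) (g k) (B k) (θ k) (d k) (v k) (w k) (t k) (lam (k + 1))
  /-- the norm on `Fin me ⊕ Fin mi → ℝ` is the maximum norm -/
  penalty : ∀ k, θ (k + 1) = max (θ k) (‖lam (k + 1)‖ + γ)
  backtracking : ∀ k, ∃ j : ℕ, α k = τ ^ j ∧
    P.LineSearchOK η (x k) (d k) (B k) (θ k) (τ ^ j) ∧
    ∀ j' < j, ¬ P.LineSearchOK η (x k) (d k) (B k) (θ k) (τ ^ j')
  step : ∀ k, x (k + 1) = x k + α k • d k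

/-! ### The potential function -/

open Classical in
/-- `F(x) = -f(x) + (σ/2) ‖x‖²` on `D` and `+∞` elsewhere. -/
noncomputable def bigF (σ : ℝ) (D : Set (EuclideanSpace ℝ (Fin n)))
    (x : EuclideanSpace ℝ (Fin n)) : EReal :=
  if x ∈ D then ((-P.f x + 1 / 2 * σ * ‖x‖ ^ 2 : ℝ) : EReal) else ⊤

/-- The pairs `(x, w)` such that `x` satisfies the constraints linearized at `w`. -/
def linFeasible : Set (EuclideanSpace ℝ (Fin n) × EuclideanSpace ℝ (Fin n)) :=
  {q | (∀ i, P.lin (Sum.inl i) q.2 (q.1 - q.2) = 0) ∧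
    ∀ i, 0 ≤ P.lin (Sum.inr i) q.2 (q.1 - q.2)}

/-- The potential function
`L(x, y, w) = -yᵀx + F*(y) + (σ/2) ‖x‖² + (l/2) ‖x - w‖² + i_C(x, w)`
on `ℝⁿ × ℝⁿ × ℝⁿ` with its Euclidean structure; `x`, `y`, `w` are the components
`0`, `1`, `2` of the argument. -/
noncomputable def potential (σ l : ℝ) (D : Set (EuclideanSpace ℝ (Fin n)))
    (z : PiLp 2 (fun _ : Fin 3 => EuclideanSpace ℝ (Fin n))) : EReal :=
  ((-inner ℝ (z 1) (z 0) : ℝ) : EReal) + conjugateFun (P.bigF σ D) (z 1) +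
    ((1 / 2 * σ * ‖z 0‖ ^ 2 + 1 / 2 * l * ‖z 0 - z 2‖ ^ 2 : ℝ) : EReal) +
    indicatorFun P.linFeasible (z 0, z 2)

end NLP

/-! ## Upper-`C²` functions and their Clarke subgradients -/

section UpperC2

variable {V : Type*} [NormedAddCommGroup V] [InnerProductSpace ℝ V]

/-! On `D` the function `f` lies below a parabola of curvature `σ` through each of its points, with
any Clarke subgradient as slope (`IsUpperC2On.le_of_mem_clarkeSubdiff`). Stationarity and
complementarity in the subproblem give `gᵀd + dᵀBd ≤ θ (v(x) - v(x + d))`, so `b ≥ σ` makes the line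
search accept the full step (`mem_and_step_eq`).

The penalty parameters stay bounded: otherwise normalized multipliers would tend to a nonzero vector
that contradicts MFCQ at an accumulation point (`bddAbove_θ`). Thanks to the margin `γ` the
multipliers are then eventually strictly below the penalty, the slacks vanish, and the iterates are
feasible (`exists_forall_feasible`).

From there on consider `z_k = (x_{k+1}, σ x_k - g_k, x_k)`. The majorant inequality says that `σ x_k
- g_k` is a subgradient of `F` at `x_k`, so Fenchel's equality turns `L(z_k)` into `f(x_k) + g_kᵀd_k
+ ((σ + l)/2)‖d_k‖²`. The condition `2b ≥ σ + l` makes this value drop by at least `(l/2)‖d_k‖²`,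
while `L` has a regular subgradient at `z_k` of norm `O(‖d_k‖)`. Both estimates involve the same
step, so the KL inequality bounds `‖d_k‖` by a telescoping difference (`summable_of_hasKLAt`). The
sequence is therefore Cauchy, and the subproblem conditions pass to the limit (`isKKT_of_tendsto`).
-/

/-- At each point of `s` the function `f` has a quadratic majorant on `s` that touches it there,
with slope at most `C` and curvature constant `r`. -/
def HasQuadraticMajorants (f : V → ℝ) (s : Set V) (C r : ℝ) : Prop :=
  ∀ y ∈ s, ∃ q : V →L[ℝ] ℝ, ‖q‖ ≤ C ∧ ∀ z ∈ s, f z ≤ f y + q (z - y) + r * ‖z - y‖ ^ 2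

/-- A continuous family indexed by a compact space is bounded uniformly near a point. -/
theorem exists_eventually_forall_norm_le {X T F : Type*} [TopologicalSpace X] [TopologicalSpace T]
    [CompactSpace T] [SeminormedAddCommGroup F] {G : T × X → F} {W : Set X} (hW : IsOpen W)
    {x₀ : X} (hx₀ : x₀ ∈ W) (hG : ContinuousOn G (Set.univ ×ˢ W)) :
    ∃ C : ℝ, 0 ≤ C ∧ ∀ᶠ x in 𝓝 x₀, ∀ t, ‖G (t, x)‖ ≤ C := by
  have hat : ∀ t, ContinuousAt G (t, x₀) := fun t =>
    hG.continuousAt ((isOpen_univ.prod hW).mem_nhds ⟨trivial, hx₀⟩)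
  have hcont : Continuous fun t => ‖G (t, x₀)‖ := continuous_iff_continuousAt.2 fun t =>
    (((hat t).comp (f := fun t => (t, x₀)) (by fun_prop)).norm)
  obtain ⟨M, hM⟩ := (isCompact_range hcont).bddAbove
  refine ⟨max M 0 + 1, by positivity, ?_⟩
  have key : ∀ᶠ x in 𝓝 x₀, ∀ t ∈ (Set.univ : Set T), ‖G (t, x)‖ ≤ max M 0 + 1 := by
    refine IsCompact.eventually_forall_of_forall_eventually isCompact_univ fun t _ => ?_
    have hswap : Tendsto (fun z : X × T => ‖G (z.2, z.1)‖) (𝓝 (x₀, t)) (𝓝 ‖G (t, x₀)‖) :=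
      ((hat t).comp (f := fun z : X × T => (z.2, z.1)) (x := (x₀, t)) (by fun_prop)).norm
    have hlt : ‖G (t, x₀)‖ < max M 0 + 1 := by
      have := hM ⟨t, rfl⟩
      have := le_max_left M 0
      simp only at *
      linarith
    exact (hswap.eventually (gt_mem_nhds hlt)).mono fun z hz => hz.le
  exact key.mono fun x hx t => hx t trivial

/-- The Taylor expansion of a function `p t` that attains the minimum at `y` bounds `f` from above;
compactness of `T` makes `C` and `r` independent of `t` and `y`. -/
theorem IsUpperC2On.exists_hasQuadraticMajorants {f : V → ℝ} {O : Set V} (hf : IsUpperC2On f O)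
    {x₀ : V} (hx₀ : x₀ ∈ O) :
    ∃ ε > 0, ∃ C r : ℝ, 0 ≤ C ∧ 0 ≤ r ∧ HasQuadraticMajorants f (Metric.ball x₀ ε) C r := by
  obtain ⟨W, T, _, _, p, hW, hxW, hp, hpc, hmin⟩ := hf x₀ hx₀
  obtain ⟨C, hC, hC'⟩ := exists_eventually_forall_norm_le hW hxW (hpc 1 (by norm_num))
  obtain ⟨r, hr, hr'⟩ := exists_eventually_forall_norm_le hW hxW (hpc 2 le_rfl)
  obtain ⟨ε, hε, hball⟩ := Metric.eventually_nhds_iff_ball.1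
    ((hC'.and hr').and (hW.mem_nhds hxW))
  refine ⟨ε, hε, C, r, hC, hr, fun y hy => ?_⟩
  obtain ⟨t, ht⟩ := (hmin y (hball y hy).2).1
  have hat : ∀ z ∈ Metric.ball x₀ ε, ContDiffAt ℝ 2 (p t) z := fun z hz =>
    (hp t).contDiffAt (hW.mem_nhds (hball z hz).2)
  have hdiff : ∀ z ∈ Metric.ball x₀ ε, DifferentiableAt ℝ (p t) z := fun z hz =>
    (hat z hz).differentiableAt (by norm_num)
  have hdiff' : ∀ z ∈ Metric.ball x₀ ε, DifferentiableAt ℝ (fderiv ℝ (p t)) z := fun z hz =>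
    ((hat z hz).fderiv_right (m := 1) (by norm_num)).differentiableAt (by norm_num)
  have hbd : ∀ z ∈ Metric.ball x₀ ε, ‖fderiv ℝ (fderiv ℝ (p t)) z‖ ≤ r := fun z hz => by
    rw [← norm_iteratedFDeriv_one, norm_iteratedFDeriv_fderiv]
    exact (hball z hz).1.2 t
  refine ⟨fderiv ℝ (p t) y, ?_, fun z hz => ?_⟩
  · rw [← norm_iteratedFDeriv_one]
    exact (hball y hy).1.1 t
  have hseg : segment ℝ y z ⊆ Metric.ball x₀ ε := (convex_ball x₀ ε).segment_subset hy hz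
  -- The mean value inequality is applied twice, to the derivative and then to `p t`; this loses the
  -- factor `1/2` of Taylor's formula, which is harmless.
  have htaylor := (convex_segment y z).norm_image_sub_le_of_norm_fderiv_le'
    (f := p t) (φ := fderiv ℝ (p t) y) (C := r * ‖z - y‖) (fun u hu => hdiff u (hseg hu))
    (fun u hu => ((convex_ball x₀ ε).norm_image_sub_le_of_norm_fderiv_le hdiff' hbd hy
      (hseg hu)).trans (by
        gcongr
        exact norm_sub_le_of_mem_segment hu))
    (left_mem_segment ℝ y z) (right_mem_segment ℝ y z)
  have h1 := (abs_le.1 (Real.norm_eq_abs _ ▸ htaylor)).2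
  have h2 : f z ≤ p t z := (hmin z (hball z hz).2).2 ⟨t, rfl⟩
  simp only at ht
  nlinarith

theorem HasQuadraticMajorants.continuousOn {f : V → ℝ} {s : Set V} {C r : ℝ}
    (h : HasQuadraticMajorants f s C r) : ContinuousOn f s := by
  have key : ∀ y ∈ s, ∀ z ∈ s, f z ≤ f y + (C * ‖z - y‖ + r * ‖z - y‖ ^ 2) := by
    intro y hy z hz
    obtain ⟨q, hq, hq'⟩ := h y hy
    have h1 := (le_abs_self _).trans ((q.le_opNorm (z - y)).trans
      (mul_le_mul_of_nonneg_right hq (norm_nonneg _)))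
    have := hq' z hz
    linarith
  intro x hx
  have hlim : Tendsto (fun z => C * ‖z - x‖ + r * ‖z - x‖ ^ 2) (𝓝[s] x) (𝓝 0) := by
    have : Continuous fun z => C * ‖z - x‖ + r * ‖z - x‖ ^ 2 := by fun_prop
    simpa using (this.tendsto x).mono_left nhdsWithin_le_nhds
  rw [ContinuousWithinAt, tendsto_iff_norm_sub_tendsto_zero]
  refine squeeze_zero' (Eventually.of_forall fun _ => norm_nonneg _) ?_ hlim
  filter_upwards [self_mem_nhdsWithin] with z hz
  have h1 := key x hx z hz
  have h2 := key z hz x hx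
  rw [norm_sub_rev x z] at h2
  rw [Real.norm_eq_abs, abs_le]
  constructor <;> linarith

/-- A Clarke subgradient is the slope of a quadratic majorant. -/
theorem HasQuadraticMajorants.le_of_mem_clarkeSubdiff {f : V → ℝ} {s : Set V} {C r : ℝ}
    (hr : 0 ≤ r) (hs : IsOpen s) (h : HasQuadraticMajorants f s C r) {x g z : V}
    (hx : x ∈ s) (hz : z ∈ s) (hg : g ∈ clarkeSubdiff f x) :
    f z ≤ f x + inner ℝ g (z - x) + r * ‖z - x‖ ^ 2 := by
  have hcont := h.continuousOn
  set v := z - x with hv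
  have hzv : x + v = z := by simp [hv]
  refine le_of_forall_pos_le_add fun e he => ?_
  -- Three errors `δ` (limsup, `f y` against `f x`, `f (y + v)` against `f z`) and one error `r δ
  -- ‖v‖²` from `t < δ` must add up to `e`.
  set δ := e / (3 + r * ‖v‖ ^ 2) with hδ
  have hden : 0 < 3 + r * ‖v‖ ^ 2 := by positivity
  have hδ0 : 0 < δ := div_pos he hden
  -- Testing the direction `-v` turns the majorant at a nearby `y` into an upper bound for its slope
  -- along `v`; the same majorant is then evaluated at `y + v`, close to `z`.
  have hfreq : ∃ᶠ q : V × ℝ in 𝓝 x ×ˢ 𝓝[>] 0,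
      ((inner ℝ g (-v) - δ : ℝ) : EReal) < (((f (q.1 + q.2 • -v) - f q.1) / q.2 : ℝ) : EReal) := by
    refine frequently_lt_of_lt_limsup (by isBoundedDefault) (lt_of_lt_of_le ?_ (hg (-v)))
    exact_mod_cast sub_lt_self _ hδ0
  have hfst : Tendsto (fun q : V × ℝ => q.1) (𝓝 x ×ˢ 𝓝[>] 0) (𝓝 x) := tendsto_fst
  have hsnd : Tendsto (fun q : V × ℝ => q.2) (𝓝 x ×ˢ 𝓝[>] 0) (𝓝[>] 0) := tendsto_snd
  have hsnd' : Tendsto (fun q : V × ℝ => q.2) (𝓝 x ×ˢ 𝓝[>] 0) (𝓝 0) :=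
    hsnd.mono_right nhdsWithin_le_nhds
  have hshift : Tendsto (fun q : V × ℝ => q.1 + q.2 • -v) (𝓝 x ×ˢ 𝓝[>] 0) (𝓝 x) := by
    simpa using hfst.add (hsnd'.smul_const (-v))
  have hadd : Tendsto (fun q : V × ℝ => q.1 + v) (𝓝 x ×ˢ 𝓝[>] 0) (𝓝 z) := by
    simpa [hzv] using hfst.add_const v
  have hfx := (hcont.continuousAt (hs.mem_nhds hx)).tendsto
  have hfz := (hcont.continuousAt (hs.mem_nhds hz)).tendsto
  have hev := (((((hfst.eventually (hs.mem_nhds hx)).and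
    (hshift.eventually (hs.mem_nhds hx))).and (hadd.eventually (hs.mem_nhds hz))).and
    (hsnd.eventually self_mem_nhdsWithin)).and (hsnd'.eventually (gt_mem_nhds hδ0))).and
    (((hfx.comp hfst).eventually (gt_mem_nhds (lt_add_of_pos_right (f x) hδ0))).and
      ((hfz.comp hadd).eventually (lt_mem_nhds (sub_lt_self (f z) hδ0))))
  obtain ⟨⟨y, t⟩, hlt, ⟨⟨⟨⟨hy, hyt⟩, hyv⟩, ht⟩, htδ⟩, h1, h2⟩ := (hfreq.and_eventually hev).exists
  simp only [Function.comp_apply] at *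
  obtain ⟨q, -, hq⟩ := h y hy
  have h3 := hq _ hyt
  have h4 := hq _ hyv
  simp only [add_sub_cancel_left, map_smul, map_neg, norm_smul, norm_neg, smul_eq_mul,
    Real.norm_eq_abs, abs_of_pos ht] at h3 h4
  have h5 := EReal.coe_lt_coe_iff.1 hlt
  rw [lt_div_iff₀ ht, inner_neg_right] at h5
  have h6 : (-inner ℝ g v - δ) < -q v + r * t * ‖v‖ ^ 2 := by
    refine lt_of_mul_lt_mul_right ?_ ht.le
    nlinarith
  have h7 : r * t * ‖v‖ ^ 2 ≤ r * δ * ‖v‖ ^ 2 := by gcongr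
  have h8 : δ * (3 + r * ‖v‖ ^ 2) = e := div_mul_cancel₀ _ hden.ne'
  nlinarith

/-- Difference quotients in the direction `g` are at most `(C + r)‖g‖` once `t‖g‖ < 1`, whereas a
subgradient `g` makes the Clarke derivative at least `‖g‖²`. -/
theorem HasQuadraticMajorants.norm_le_of_mem_clarkeSubdiff {f : V → ℝ} {s : Set V} {C r : ℝ}
    (hr : 0 ≤ r) (hs : IsOpen s) (h : HasQuadraticMajorants f s C r) {x g : V}
    (hx : x ∈ s) (hg : g ∈ clarkeSubdiff f x) : ‖g‖ ≤ C + r := by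
  have hfst : Tendsto (fun q : V × ℝ => q.1) (𝓝 x ×ˢ 𝓝[>] 0) (𝓝 x) := tendsto_fst
  have hsnd : Tendsto (fun q : V × ℝ => q.2) (𝓝 x ×ˢ 𝓝[>] 0) (𝓝[>] 0) := tendsto_snd
  have hsnd' : Tendsto (fun q : V × ℝ => q.2) (𝓝 x ×ˢ 𝓝[>] 0) (𝓝 0) :=
    hsnd.mono_right nhdsWithin_le_nhds
  have hsmul : Tendsto (fun q : V × ℝ => ‖q.2 • g‖) (𝓝 x ×ˢ 𝓝[>] 0) (𝓝 0) := by
    simpa using (hsnd'.smul_const g).norm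
  have hshift : Tendsto (fun q : V × ℝ => q.1 + q.2 • g) (𝓝 x ×ˢ 𝓝[>] 0) (𝓝 x) := by
    simpa using hfst.add (hsnd'.smul_const g)
  have hle : clarkeDeriv f x g ≤ (((C + r) * ‖g‖ : ℝ) : EReal) := by
    refine limsup_le_of_le (by isBoundedDefault) ?_
    filter_upwards [hfst.eventually (hs.mem_nhds hx), hshift.eventually (hs.mem_nhds hx),
      hsnd.eventually self_mem_nhdsWithin, hsmul.eventually (gt_mem_nhds one_pos)]
      with ⟨y, t⟩ hy hyt ht h1
    simp only at *
    obtain ⟨q, hqC, hq⟩ := h y hy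
    have h2 := hq _ hyt
    have h3 := (le_abs_self _).trans ((q.le_opNorm g).trans
      (mul_le_mul_of_nonneg_right hqC (norm_nonneg _)))
    simp only [add_sub_cancel_left, map_smul, norm_smul, smul_eq_mul, Real.norm_eq_abs,
      abs_of_pos ht] at h1 h2
    refine EReal.coe_le_coe_iff.2 ?_
    rw [div_le_iff₀ ht]
    have h4 : r * (t * ‖g‖) ^ 2 ≤ r * (t * ‖g‖) := by
      have : 0 ≤ t * ‖g‖ := by positivity
      gcongr
      nlinarith
    nlinarith
  have h1 := EReal.coe_le_coe_iff.1 ((hg g).trans hle)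
  rw [real_inner_self_eq_norm_sq] at h1
  rcases (norm_nonneg g).eq_or_lt with h0 | h0
  · rw [← h0]
    obtain ⟨q, hq, -⟩ := h x hx
    linarith [norm_nonneg q]
  · nlinarith

/-- The graph of the Clarke subdifferential is closed. -/
theorem mem_clarkeSubdiff_of_tendsto {ι : Type*} {F : Filter ι} [F.NeBot] {f : V → ℝ}
    {u h : ι → V} {x g : V} (hu : Tendsto u F (𝓝 x)) (hh : Tendsto h F (𝓝 g))
    (hmem : ∀ i, h i ∈ clarkeSubdiff f (u i)) : g ∈ clarkeSubdiff f x := by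
  intro v
  refine le_of_forall_gt_imp_ge_of_dense fun a ha => ?_
  have hev : ∀ᶠ q : V × ℝ in 𝓝 x ×ˢ 𝓝[>] 0,
      (((f (q.1 + q.2 • v) - f q.1) / q.2 : ℝ) : EReal) < a :=
    eventually_lt_of_limsup_lt ha (by isBoundedDefault)
  obtain ⟨A, hA, B, hB, hAB⟩ := eventually_prod_iff.1 hev
  -- Upper semicontinuity of the Clarke derivative in its base point: a bound on difference
  -- quotients near `x` is also one near every `y` close to `x`.
  have h1 : ∀ᶠ y in 𝓝 x, clarkeDeriv f y v ≤ a := by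
    filter_upwards [hA.eventually_nhds] with y hy
    exact limsup_le_of_le (by isBoundedDefault)
      ((hy.prod_mk hB).mono fun q hq => (hAB hq.1 hq.2).le)
  have h2 : ∀ᶠ i in F, ((inner ℝ (h i) v : ℝ) : EReal) ≤ a :=
    (hu.eventually h1).mono fun i hi => (hmem i v).trans hi
  refine le_of_tendsto ?_ h2
  exact (continuous_coe_real_ereal.tendsto _).comp (hh.inner tendsto_const_nhds)

theorem IsUpperC2On.continuousOn {f : V → ℝ} {O : Set V} (hf : IsUpperC2On f O) :
    ContinuousOn f O := fun x hx => by
  obtain ⟨ε, hε, C, r, hC, hr, h⟩ := hf.exists_hasQuadraticMajorants hx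
  exact ((h.continuousOn).continuousAt (Metric.ball_mem_nhds x hε)).continuousWithinAt

theorem IsUpperC2On.exists_norm_clarkeSubdiff_le {f : V → ℝ} {O D : Set V}
    (hf : IsUpperC2On f O) (hD : IsCompact D) (hDO : D ⊆ O) :
    ∃ M : ℝ, 0 ≤ M ∧ ∀ x ∈ D, ∀ g ∈ clarkeSubdiff f x, ‖g‖ ≤ M := by
  refine hD.induction_on (p := fun S => ∃ M : ℝ, 0 ≤ M ∧
    ∀ x ∈ S, ∀ g ∈ clarkeSubdiff f x, ‖g‖ ≤ M) ⟨0, le_rfl, by simp⟩ ?_ ?_ ?_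
  · rintro S S' hS ⟨M, hM, h⟩
    exact ⟨M, hM, fun x hx => h x (hS hx)⟩
  · rintro S S' ⟨M, hM, h⟩ ⟨M', hM', h'⟩
    refine ⟨max M M', le_max_of_le_left hM, ?_⟩
    rintro x (hx | hx) g hg
    · exact (h x hx g hg).trans (le_max_left _ _)
    · exact (h' x hx g hg).trans (le_max_right _ _)
  · intro x hx
    obtain ⟨ε, hε, C, r, hC, hr, h⟩ := hf.exists_hasQuadraticMajorants (hDO hx)
    exact ⟨Metric.ball x ε, mem_nhdsWithin_of_mem_nhds (Metric.ball_mem_nhds x hε), C + r,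
      by positivity, fun y hy g hg => h.norm_le_of_mem_clarkeSubdiff hr Metric.isOpen_ball hy hg⟩

/-- On a convex set where `-f + (ρ/2) ‖·‖²` is convex, every Clarke subgradient of an upper-`C²`
function gives a global quadratic majorant with curvature `ρ`. -/
theorem IsUpperC2On.le_of_mem_clarkeSubdiff {f : V → ℝ} {O D : Set V} (hf : IsUpperC2On f O)
    (hDO : D ⊆ O) {ρ : ℝ} (hconv : ConvexOn ℝ D fun x => -f x + 1 / 2 * ρ * ‖x‖ ^ 2)
    {x y g : V} (hx : x ∈ D) (hy : y ∈ D) (hg : g ∈ clarkeSubdiff f x) :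
    f y ≤ f x + inner ℝ g (y - x) + ρ / 2 * ‖y - x‖ ^ 2 := by
  obtain ⟨ε, hε, C, r, hC, hr, h⟩ := hf.exists_hasQuadraticMajorants (hDO hx)
  have hlim : Tendsto (fun s : ℝ => x + s • (y - x)) (𝓝[>] 0) (𝓝 x) := by
    have : Continuous fun s : ℝ => x + s • (y - x) := by fun_prop
    simpa using (this.tendsto 0).mono_left nhdsWithin_le_nhds
  have hev : ∀ᶠ s : ℝ in 𝓝[>] 0, f y ≤ f x + inner ℝ g (y - x) + ρ / 2 * ‖y - x‖ ^ 2
      + s * ((r - ρ / 2) * ‖y - x‖ ^ 2) := by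
    filter_upwards [hlim.eventually (Metric.ball_mem_nhds x hε), self_mem_nhdsWithin,
      nhdsWithin_le_nhds (gt_mem_nhds (one_pos : (0 : ℝ) < 1))] with s hsb hs0 hs1
    simp only [Set.mem_Ioi] at hs0
    have h1 := h.le_of_mem_clarkeSubdiff hr Metric.isOpen_ball (Metric.mem_ball_self hε) hsb hg
    -- Convexity bounds `f` from below on the segment, the local majorant from above. After division
    -- by `s` the local curvature `r` survives only in a term of order `s`.
    have h2 := hconv.2 hx hy (sub_nonneg.2 hs1.le) hs0.le (by ring)
    have hpt : (1 - s) • x + s • y = x + s • (y - x) := by module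
    have hy' : y = x + (y - x) := by abel
    simp only [hpt, smul_eq_mul] at h2
    simp only [add_sub_cancel_left, inner_smul_right, norm_smul, Real.norm_eq_abs,
      abs_of_pos hs0] at h1
    have e1 : ‖x + s • (y - x)‖ ^ 2
        = ‖x‖ ^ 2 + 2 * (s * inner ℝ x (y - x)) + (s * ‖y - x‖) ^ 2 := by
      rw [norm_add_sq_real, inner_smul_right, norm_smul, Real.norm_eq_abs, abs_of_pos hs0]
    have e2 : ‖y‖ ^ 2 = ‖x‖ ^ 2 + 2 * inner ℝ x (y - x) + ‖y - x‖ ^ 2 := by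
      conv_lhs => rw [hy']
      rw [norm_add_sq_real]
    rw [e1, e2] at h2
    refine le_of_mul_le_mul_left ?_ hs0
    nlinarith
  have hlim2 : Tendsto (fun s : ℝ => f x + inner ℝ g (y - x) + ρ / 2 * ‖y - x‖ ^ 2
      + s * ((r - ρ / 2) * ‖y - x‖ ^ 2)) (𝓝[>] 0)
      (𝓝 (f x + inner ℝ g (y - x) + ρ / 2 * ‖y - x‖ ^ 2)) := by
    have : Continuous fun s : ℝ => f x + inner ℝ g (y - x) + ρ / 2 * ‖y - x‖ ^ 2
      + s * ((r - ρ / 2) * ‖y - x‖ ^ 2) := by fun_prop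
    simpa using (this.tendsto 0).mono_left nhdsWithin_le_nhds
  exact ge_of_tendsto hlim2 hev

end UpperC2

/-! ## Finite length of descent sequences under the Kurdyka-Łojasiewicz property -/

section KL

/-- Differentiability is required only for `s' < s`, since a KL function `φ` need not be
differentiable at the endpoint `0`. -/
theorem ConcaveOn.deriv_mul_sub_le {S : Set ℝ} {φ : ℝ → ℝ} (hφ : ConcaveOn ℝ S φ) {s s' : ℝ}
    (hs : s ∈ S) (hs' : s' ∈ S) (hle : s' ≤ s) (hd : s' < s → DifferentiableAt ℝ φ s) :
    deriv φ s * (s - s') ≤ φ s - φ s' := by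
  rcases hle.eq_or_lt with rfl | hlt
  · simp
  · have := hφ.deriv_le_slope hs' hs hlt (hd hlt)
    rwa [slope_def_field, le_div_iff₀ (sub_pos.2 hlt)] at this

theorem summable_of_forall_telescoping {δ Φ : ℕ → ℝ} (hδ : ∀ k, 0 ≤ δ k)
    (h : ∀ᶠ k in atTop, 0 ≤ Φ k ∧ δ k ≤ Φ k - Φ (k + 1)) : Summable δ := by
  obtain ⟨N, hN⟩ := eventually_atTop.1 h
  rw [← summable_nat_add_iff N]
  refine summable_of_sum_range_le (c := Φ N) (fun k => hδ _) fun m => ?_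
  have hsum : ∀ m, ∑ k ∈ Finset.range m, δ (k + N) ≤ Φ N - Φ (m + N) := by
    intro m
    induction m with
    | zero => simp
    | succ m ih =>
      rw [Finset.sum_range_succ]
      have := (hN (m + N) (by omega)).2
      rw [show m + 1 + N = m + N + 1 by ring]
      linarith
  have := hsum m
  have := (hN (m + N) (by omega)).1
  linarith

variable {V : Type*} [NormedAddCommGroup V] [InnerProductSpace ℝ V]

/-- A telescoping majorant of the step lengths near a point with the KL property. -/
theorem HasKLAt.exists_telescoping {L : V → EReal} {z : ℕ → V} {s δ : ℕ → ℝ} {sbar a C : ℝ}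
    {zbar : V} (hz : HasKLAt L zbar) (hbar : L zbar = sbar) (hL : ∀ k, L (z k) = s k)
    (hs : Tendsto s atTop (𝓝 sbar)) (ha : 0 < a) (hC : 0 ≤ C) (hδ : ∀ k, 0 ≤ δ k)
    (hdesc : ∀ k, s (k + 1) ≤ s k - a * δ k ^ 2)
    (hsub : ∀ k, ∃ h ∈ generalSubdiff L (z k), ‖h‖ ≤ C * δ k) :
    ∃ U ∈ 𝓝 zbar, ∃ Φ : ℕ → ℝ, ∀ᶠ k in atTop,
      0 ≤ Φ k ∧ Φ (k + 1) ≤ Φ k ∧ (z k ∈ U → δ k ≤ Φ k - Φ (k + 1)) := by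
  obtain ⟨η, U, φ, hη, hU, -, hconc, hnonneg, -, -, hpos, hkl⟩ := hz
  have hanti : Antitone s := antitone_nat_of_succ_le fun k =>
    (hdesc k).trans (sub_le_self _ (by positivity))
  have hge : ∀ k, 0 ≤ s k - sbar := fun k => sub_nonneg.2 (hanti.le_of_tendsto hs k)
  have hlim : Tendsto (fun k => ((s k - sbar : ℝ) : EReal)) atTop (𝓝 0) := by
    have : Tendsto (fun k => s k - sbar) atTop (𝓝 0) := by simpa using hs.sub_const sbar
    exact (continuous_coe_real_ereal.tendsto 0).comp this
  -- Concavity bounds `φ' · a δ_k²` by the decrease of `φ`, and the KL inequality gives `φ' · C δ_k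
  -- ≥ 1`. Combining them leaves `δ_k` to the first power with factor `C / a`.
  refine ⟨U, hU, fun k => C / a * φ (s k - sbar), ?_⟩
  filter_upwards [hlim.eventually (gt_mem_nhds hη)] with k hk
  have hle : s (k + 1) - sbar ≤ s k - sbar := by linarith [hanti k.le_succ]
  have hmem : s k - sbar ∈ {t : ℝ | 0 ≤ t ∧ (t : EReal) < η} := ⟨hge k, hk⟩
  have hmem' : s (k + 1) - sbar ∈ {t : ℝ | 0 ≤ t ∧ (t : EReal) < η} :=
    ⟨hge _, (EReal.coe_le_coe_iff.2 hle).trans_lt hk⟩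
  -- A nonzero `deriv` certifies differentiability, because its default value is `0`.
  have hda : 0 < s k - sbar → DifferentiableAt ℝ φ (s k - sbar) := fun h0 =>
    differentiableAt_of_deriv_ne_zero (hpos _ h0 hk).ne'
  have htan := hconc.deriv_mul_sub_le hmem hmem' hle
    fun hlt => hda ((hge (k + 1)).trans_lt hlt)
  have hCa : 0 ≤ C / a := by positivity
  have hmono : φ (s (k + 1) - sbar) ≤ φ (s k - sbar) := by
    rcases (hge k).eq_or_lt with h0 | h0
    · rw [show s (k + 1) - sbar = s k - sbar by linarith [hge (k + 1)]]
    · have : 0 ≤ deriv φ (s k - sbar) * (s k - sbar - (s (k + 1) - sbar)) :=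
        mul_nonneg (hpos _ h0 hk).le (sub_nonneg.2 hle)
      linarith
  refine ⟨mul_nonneg hCa (hnonneg _ hmem.1 hk), mul_le_mul_of_nonneg_left hmono hCa,
    fun hzU => ?_⟩
  rw [← mul_sub]
  rcases (hge k).eq_or_lt with h0 | h0
  · have h1 : a * δ k ^ 2 ≤ 0 := by linarith [hdesc k, hge (k + 1)]
    have h2 : δ k ^ 2 = 0 := le_antisymm (nonpos_of_mul_nonpos_right h1 ha) (sq_nonneg _)
    rw [pow_eq_zero_iff two_ne_zero] at h2
    rw [h2]
    exact mul_nonneg hCa (sub_nonneg.2 hmono)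
  · obtain ⟨h, hh, hhC⟩ := hsub k
    have h1 := hkl (z k) hzU (by rw [hbar, hL]; exact_mod_cast sub_pos.1 h0) (by
      rw [hbar, hL, show s k = sbar + (s k - sbar) by ring, EReal.coe_add]
      exact EReal.add_lt_add_left_coe hk sbar)
    rw [hbar, hL, EReal.toReal_coe, EReal.toReal_coe] at h1
    have h2 : Metric.infEDist 0 (generalSubdiff L (z k)) ≤ ENNReal.ofReal (C * δ k) := by
      refine (Metric.infEDist_le_edist_of_mem hh).trans ?_
      rw [edist_dist, dist_zero_left]
      exact ENNReal.ofReal_le_ofReal hhC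
    have hp := hpos _ h0 hk
    have h3 : 1 ≤ deriv φ (s k - sbar) * (C * δ k) := by
      have h4 := h1.trans (mul_le_mul_right h2 _)
      rwa [← ENNReal.ofReal_mul hp.le, ENNReal.one_le_ofReal] at h4
    have h5 : deriv φ (s k - sbar) * (a * δ k ^ 2) ≤ φ (s k - sbar) - φ (s (k + 1) - sbar) :=
      (mul_le_mul_of_nonneg_left (by linarith [hdesc k]) hp.le).trans htan
    have h6 := mul_le_mul_of_nonneg_left h5 hCa
    have h7 : C / a * (deriv φ (s k - sbar) * (a * δ k ^ 2))
        = δ k * (deriv φ (s k - sbar) * (C * δ k)) := by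
      field_simp
    rw [h7] at h6
    nlinarith [mul_le_mul_of_nonneg_left h3 (hδ k)]

/-- A bounded descent sequence with relatively small subgradients has finite length if the KL
property holds at its cluster points. -/
theorem summable_of_hasKLAt {L : V → EReal} {z : ℕ → V} {s δ : ℕ → ℝ} {sbar a C : ℝ} {K : Set V}
    (hK : IsCompact K) (hzK : ∀ k, z k ∈ K)
    (hcluster : ∀ zbar, MapClusterPt zbar atTop z → HasKLAt L zbar ∧ L zbar = sbar)
    (hL : ∀ k, L (z k) = s k) (hs : Tendsto s atTop (𝓝 sbar)) (ha : 0 < a) (hC : 0 ≤ C)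
    (hδ : ∀ k, 0 ≤ δ k) (hdesc : ∀ k, s (k + 1) ≤ s k - a * δ k ^ 2)
    (hsub : ∀ k, ∃ h ∈ generalSubdiff L (z k), ‖h‖ ≤ C * δ k) : Summable δ := by
  have key : ∃ Φ : ℕ → ℝ, ∀ᶠ k in atTop,
      0 ≤ Φ k ∧ Φ (k + 1) ≤ Φ k ∧ (z k ∈ K → δ k ≤ Φ k - Φ (k + 1)) := by
    refine hK.induction_on (p := fun S => ∃ Φ : ℕ → ℝ, ∀ᶠ k in atTop,
      0 ≤ Φ k ∧ Φ (k + 1) ≤ Φ k ∧ (z k ∈ S → δ k ≤ Φ k - Φ (k + 1))) ⟨0, by simp⟩ ?_ ?_ ?_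
    · rintro S S' hS ⟨Φ, h⟩
      exact ⟨Φ, h.mono fun k hk => ⟨hk.1, hk.2.1, fun hz => hk.2.2 (hS hz)⟩⟩
    · rintro S S' ⟨Φ, h⟩ ⟨Φ', h'⟩
      -- Each `Φ` is nonincreasing even while `z k` is outside its set, so the sum serves the union.
      -- A finite cover of `K` thus replaces any argument that traps the sequence in one
      -- neighborhood.
      refine ⟨Φ + Φ', ?_⟩
      filter_upwards [h, h'] with k ⟨h1, h2, h3⟩ ⟨h1', h2', h3'⟩
      simp only [Pi.add_apply]
      refine ⟨add_nonneg h1 h1', add_le_add h2 h2', ?_⟩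
      rintro (hz | hz)
      · linarith [h3 hz]
      · linarith [h3' hz]
    · intro zbar _
      by_cases hc : MapClusterPt zbar atTop z
      · obtain ⟨U, hU, Φ, h⟩ := (hcluster zbar hc).1.exists_telescoping (hcluster zbar hc).2
          hL hs ha hC hδ hdesc hsub
        exact ⟨U, mem_nhdsWithin_of_mem_nhds hU, Φ, h⟩
      · rw [mapClusterPt_iff_frequently] at hc
        push Not at hc
        obtain ⟨U, hU, h⟩ := hc
        refine ⟨U, mem_nhdsWithin_of_mem_nhds hU, 0, h.mono fun k hk => ?_⟩
        exact ⟨le_rfl, le_rfl, fun hz => absurd hz hk⟩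
  obtain ⟨Φ, hΦ⟩ := key
  exact summable_of_forall_telescoping hδ (hΦ.mono fun k hk => ⟨hk.1, hk.2.2 (hzK k)⟩)

theorem regularSubdiff_subset_generalSubdiff (L : V → EReal) (z : V) :
    regularSubdiff L z ⊆ generalSubdiff L z := fun h hh =>
  ⟨hh.1, hh.2.1, fun _ => z, fun _ => h, tendsto_const_nhds, tendsto_const_nhds, fun _ => hh,
    tendsto_const_nhds⟩

end KL

/-! ## The SQP iteration -/

/-- Limits along one ultrafilter replace the successive extraction of subsequences for iterates,
subgradients and multipliers. -/
theorem IsCompact.exists_tendsto_ultrafilter {X ι : Type*} [TopologicalSpace X] {K : Set X}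
    (hK : IsCompact K) (F : Ultrafilter ι) {u : ι → X} (hu : ∀ i, u i ∈ K) :
    ∃ a ∈ K, Tendsto u F (𝓝 a) :=
  hK.ultrafilter_le_nhds (F.map u) (tendsto_principal.2 (Eventually.of_forall hu))

/-! ### Affine constraints, violation and subproblem multipliers -/

namespace NLP

variable {n me mi : ℕ} {P : NLP n me mi}

theorem AffineConstraints.exists_normals (haff : P.AffineConstraints) :
    ∃ a : Fin me ⊕ Fin mi → EuclideanSpace ℝ (Fin n), (∀ i x, gradient (P.c i) x = a i) ∧
      ∀ i x y, P.c i y = P.c i x + inner ℝ (a i) (y - x) := by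
  choose a β h using haff
  refine ⟨a, fun i x => ?_, fun i x y => ?_⟩
  · refine HasGradientAt.gradient ?_
    rw [show P.c i = fun x => inner ℝ (a i) x + β i from funext (h i), hasGradientAt_iff_hasFDerivAt]
    exact ((InnerProductSpace.toDual ℝ _ (a i)).hasFDerivAt).add_const (β i)
  · rw [h, h, inner_sub_right]
    ring

/-- Linearization is exact for affine functions; as a consequence the set `linFeasible` does not
restrict its second component. -/
theorem AffineConstraints.lin_eq (haff : P.AffineConstraints) (i : Fin me ⊕ Fin mi)
    (x d : EuclideanSpace ℝ (Fin n)) : P.lin i x d = P.c i (x + d) := by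
  obtain ⟨a, ha, hc⟩ := haff.exists_normals
  rw [lin, ha, hc i x (x + d), add_sub_cancel_left]

theorem AffineConstraints.continuous (haff : P.AffineConstraints) (i : Fin me ⊕ Fin mi) :
    Continuous (P.c i) := by
  obtain ⟨a, β, h⟩ := haff i
  rw [show P.c i = fun x => inner ℝ a x + β from funext h]
  fun_prop

theorem AffineConstraints.mem_linFeasible (haff : P.AffineConstraints)
    {q : EuclideanSpace ℝ (Fin n) × EuclideanSpace ℝ (Fin n)} :
    q ∈ P.linFeasible ↔ q.1 ∈ P.feasible := by
  simp [linFeasible, feasible, haff.lin_eq]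

theorem AffineConstraints.isClosed_feasible (haff : P.AffineConstraints) :
    IsClosed P.feasible := by
  have : P.feasible = (⋂ i, {x | P.c (Sum.inl i) x = 0}) ∩ ⋂ i, {x | 0 ≤ P.c (Sum.inr i) x} := by
    ext
    simp [feasible]
  rw [this]
  exact (isClosed_iInter fun i => isClosed_eq (haff.continuous _) continuous_const).inter
    (isClosed_iInter fun i => isClosed_le continuous_const (haff.continuous _))

theorem violation_nonneg (x : EuclideanSpace ℝ (Fin n)) : 0 ≤ P.violation x :=
  add_nonneg (Finset.sum_nonneg fun _ _ => abs_nonneg _)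
    (Finset.sum_nonneg fun _ _ => le_max_left _ _)

theorem violation_eq_zero {x : EuclideanSpace ℝ (Fin n)} (hx : x ∈ P.feasible) :
    P.violation x = 0 := by
  simp [violation, hx.1, hx.2]

theorem neg_ineq_le_violation (x : EuclideanSpace ℝ (Fin n)) (i : Fin mi) :
    -P.c (Sum.inr i) x ≤ P.violation x := by
  have h1 := Finset.single_le_sum (f := fun i => max 0 (-P.c (Sum.inr i) x))
    (fun i _ => le_max_left _ _) (Finset.mem_univ i)
  have h2 : 0 ≤ ∑ i, |P.c (Sum.inl i) x| := Finset.sum_nonneg fun _ _ => abs_nonneg _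
  have h3 := le_max_right 0 (-P.c (Sum.inr i) x)
  simp only [violation] at *
  linarith

theorem AffineConstraints.violation_add_le (haff : P.AffineConstraints)
    {x d : EuclideanSpace ℝ (Fin n)} {v w : Fin me → ℝ} {t : Fin mi → ℝ}
    (h : P.SubFeasible x d v w t) : P.violation (x + d) ≤ ∑ i, (v i + w i) + ∑ i, t i := by
  obtain ⟨h1, h2, h3, h4, h5⟩ := h
  refine add_le_add (Finset.sum_le_sum fun i _ => ?_) (Finset.sum_le_sum fun i _ => ?_)
  · rw [← haff.lin_eq, h1, abs_le]
    constructor <;> linarith [h3 i, h4 i]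
  · rw [← haff.lin_eq]
    exact max_le (h5 i) (by linarith [h2 i])

/-- The predicted decrease is bounded by the decrease of the violation. -/
theorem IsSubMultiplier.inner_add_le (haff : P.AffineConstraints)
    {x g d : EuclideanSpace ℝ (Fin n)} {B : EuclideanSpace ℝ (Fin n) →L[ℝ] EuclideanSpace ℝ (Fin n)}
    {θ : ℝ} {v w : Fin me → ℝ} {t : Fin mi → ℝ} {lam : Fin me ⊕ Fin mi → ℝ}
    (hθ : 0 ≤ θ) (h : P.IsSubMultiplier x g B θ d v w t lam) :
    inner ℝ g d + inner ℝ d (B d) ≤ θ * (P.violation x - P.violation (x + d)) := by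
  obtain ⟨a, ha, hc⟩ := haff.exists_normals
  obtain ⟨hstat, hfeas, hcomp, hlam, p, q, r, hp, hq, hr, hpv, hqw, hrt, hp0, hq0, hr0⟩ := h
  have hvio := haff.violation_add_le hfeas
  obtain ⟨h1, h2, h3, h4, h5⟩ := hfeas
  have hsum : inner ℝ g d + inner ℝ d (B d)
      = ∑ i, lam i * (P.c i (x + d) - P.c i x) := by
    rw [real_inner_comm (B d) d, ← inner_add_left, sub_eq_zero.1 hstat, sum_inner]
    refine Finset.sum_congr rfl fun i _ => ?_
    rw [ha, hc i x (x + d), real_inner_smul_left, add_sub_cancel_left, add_sub_cancel_left]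
  have hE : ∑ i, lam (Sum.inl i) * (P.c (Sum.inl i) (x + d) - P.c (Sum.inl i) x)
      ≤ ∑ i, θ * (|P.c (Sum.inl i) x| - (v i + w i)) := by
    refine Finset.sum_le_sum fun i _ => ?_
    rw [← haff.lin_eq, h1]
    -- Complementarity with the bounds on the slacks turns `λ (v - w)` into `-θ (v + w)`.
    have e1 : (θ + lam (Sum.inl i)) * v i = 0 := by
      rw [show θ + lam (Sum.inl i) = p i by linarith [hp i], hpv]
    have e2 : (θ - lam (Sum.inl i)) * w i = 0 := by
      rw [show θ - lam (Sum.inl i) = q i by linarith [hq i], hqw]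
    have e3 : |lam (Sum.inl i)| ≤ θ :=
      abs_le.2 ⟨by linarith [hp i, hp0 i], by linarith [hq i, hq0 i]⟩
    have e4 : -(lam (Sum.inl i) * P.c (Sum.inl i) x) ≤ θ * |P.c (Sum.inl i) x| := by
      refine (neg_le_abs _).trans ?_
      rw [abs_mul]
      gcongr
    linarith
  have hI : ∑ i, lam (Sum.inr i) * (P.c (Sum.inr i) (x + d) - P.c (Sum.inr i) x)
      ≤ ∑ i, θ * (max 0 (-P.c (Sum.inr i) x) - t i) := by
    refine Finset.sum_le_sum fun i _ => ?_
    rw [← haff.lin_eq]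
    have e1 : (θ - lam (Sum.inr i)) * t i = 0 := by
      rw [show θ - lam (Sum.inr i) = r i by linarith [hr i], hrt]
    have e3 : lam (Sum.inr i) ≤ θ := by linarith [hr i, hr0 i]
    have e4 : lam (Sum.inr i) * -P.c (Sum.inr i) x ≤ θ * max 0 (-P.c (Sum.inr i) x) :=
        (mul_le_mul_of_nonneg_left (le_max_right 0 _) (hlam i)).trans
          (mul_le_mul_of_nonneg_right e3 (le_max_left _ _))
    have e5 := hcomp i
    nlinarith
  rw [hsum, Fintype.sum_sum_type]
  have hvx : P.violation x = ∑ i, |P.c (Sum.inl i) x| + ∑ i, max 0 (-P.c (Sum.inr i) x) := rfl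
  rw [← Finset.mul_sum, Finset.sum_sub_distrib] at hE hI
  nlinarith [mul_le_mul_of_nonneg_left hvio hθ]

/-- Multipliers below the penalty parameter force the slacks to vanish. -/
theorem IsSubMultiplier.feasible_of_norm_lt (haff : P.AffineConstraints)
    {x g d : EuclideanSpace ℝ (Fin n)} {B : EuclideanSpace ℝ (Fin n) →L[ℝ] EuclideanSpace ℝ (Fin n)}
    {θ : ℝ} {v w : Fin me → ℝ} {t : Fin mi → ℝ} {lam : Fin me ⊕ Fin mi → ℝ}
    (h : P.IsSubMultiplier x g B θ d v w t lam) (hlt : ‖lam‖ < θ) :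
    x + d ∈ P.feasible ∧ ∀ i, lam (Sum.inr i) * P.c (Sum.inr i) (x + d) = 0 := by
  obtain ⟨-, ⟨h1, h2, h3, h4, h5⟩, hcomp, hlam, p, q, r, hp, hq, hr, hpv, hqw, hrt, -, -, -⟩ := h
  have hl : ∀ i, -θ < lam i ∧ lam i < θ := fun i =>
    abs_lt.1 ((norm_le_pi_norm lam i).trans_lt hlt)
  have hv : ∀ i, v i = 0 := fun i => (mul_eq_zero.1 (hpv i)).resolve_left (by
    intro h0
    linarith [hp i, (hl (Sum.inl i)).1])
  have hw : ∀ i, w i = 0 := fun i => (mul_eq_zero.1 (hqw i)).resolve_left (by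
    intro h0
    linarith [hq i, (hl (Sum.inl i)).2])
  have ht : ∀ i, t i = 0 := fun i => (mul_eq_zero.1 (hrt i)).resolve_left (by
    intro h0
    linarith [hr i, (hl (Sum.inr i)).2])
  simp only [haff.lin_eq, hv, hw, ht, sub_zero, neg_zero, add_zero] at h1 h2 hcomp
  exact ⟨⟨h1, h2⟩, hcomp⟩

/-- Clarke subgradients give quadratic majorants with curvature `σ` on `D`:
`f y ≤ f x + ⟪g, y - x⟫ + (σ/2) ‖y - x‖²`. -/
def HasClarkeMajorants (P : NLP n me mi) (D : Set (EuclideanSpace ℝ (Fin n))) (σ : ℝ) : Prop :=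
  ∀ x ∈ D, ∀ y ∈ D, ∀ g ∈ clarkeSubdiff P.f x,
    P.f y ≤ P.f x + inner ℝ g (y - x) + σ / 2 * ‖y - x‖ ^ 2

/-! ### Full steps and the size of the violation -/

namespace SQPRun

variable {η τ γ : ℝ} {R : P.SQPRun η τ γ} {D : Set (EuclideanSpace ℝ (Fin n))}

theorem θ_mono (R : P.SQPRun η τ γ) : Monotone R.θ := monotone_nat_of_le_succ fun k => by
  rw [R.penalty]
  exact le_max_left _ _

theorem θ_pos (R : P.SQPRun η τ γ) (k : ℕ) : 0 < R.θ k :=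
  R.θ_zero_pos.trans_le (R.θ_mono k.zero_le)

/-- The full step is always accepted, and the iterates remain in `D`. -/
theorem mem_and_step_eq (haff : P.AffineConstraints) {σ b : ℝ} (hmaj : P.HasClarkeMajorants D σ)
    (hη : η < 1) (hx0 : R.x 0 ∈ D) (htrial : ∀ k, R.x k + R.d k ∈ D) (hb : 0 ≤ b)
    (hBb : ∀ k y, b * ‖y‖ ^ 2 ≤ inner ℝ y (R.B k y)) (hσ : σ ≤ b) (k : ℕ) :
    R.x k ∈ D ∧ R.x (k + 1) = R.x k + R.d k := by
  have hstep : ∀ k, R.x k ∈ D → R.x (k + 1) = R.x k + R.d k := by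
    intro k hk
    -- The merit decrease is at least `dᵀBd - (σ/2)‖d‖² ≥ (1/2) dᵀBd`, which exceeds what `η < 1`
    -- asks for.
    have hls : P.LineSearchOK η (R.x k) (R.d k) (R.B k) (R.θ k) (τ ^ 0) := by
      have h1 := hmaj _ hk _ (htrial k) _ (R.subgrad k)
      have h2 := (R.multiplier k).inner_add_le haff (R.θ_pos k).le
      have h3 := hBb k (R.d k)
      have h4 : σ * ‖R.d k‖ ^ 2 ≤ b * ‖R.d k‖ ^ 2 := by gcongr
      have h5 : 0 ≤ b * ‖R.d k‖ ^ 2 := by positivity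
      rw [add_sub_cancel_left] at h1
      simp only [LineSearchOK, merit, pow_zero, one_smul]
      nlinarith
    obtain ⟨j, hα, -, hj⟩ := R.backtracking k
    have hj0 : j = 0 := by
      by_contra hne
      exact hj 0 (Nat.pos_of_ne_zero hne) hls
    rw [R.step, hα, hj0, pow_zero, one_smul]
  have hmem : ∀ k, R.x k ∈ D := by
    intro k
    induction k with
    | zero => exact hx0
    | succ k ih =>
      rw [hstep k ih]
      exact htrial k
  exact ⟨hmem k, hstep k (hmem k)⟩

/-- Comparison of the subproblem solution with the step to a feasible point. -/
theorem exists_mul_violation_le (haff : P.AffineConstraints) (hne : P.feasible.Nonempty)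
    (hΩD : P.feasible ⊆ D) (hD : IsCompact D) (hxD : ∀ k, R.x k ∈ D)
    (hstep : ∀ k, R.x (k + 1) = R.x k + R.d k) {M β : ℝ}
    (hM : ∀ k, ‖R.g k‖ ≤ M) (hβ : ∀ k, ‖R.B k‖ ≤ β) (hB0 : ∀ k y, 0 ≤ inner ℝ y (R.B k y)) :
    ∃ C : ℝ, ∀ k, R.θ k * P.violation (R.x (k + 1)) ≤ C := by
  obtain ⟨z, hz⟩ := hne
  obtain ⟨r, hr⟩ := hD.isBounded.exists_norm_le
  have hM0 : 0 ≤ M := (norm_nonneg _).trans (hM 0)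
  have hβ0 : 0 ≤ β := (norm_nonneg _).trans (hβ 0)
  have hr0 : 0 ≤ r := (norm_nonneg _).trans (hr z (hΩD hz))
  refine ⟨M * (2 * r) + M * (2 * r) + 1 / 2 * (2 * r * (β * (2 * r))), fun k => ?_⟩
  -- The step to a feasible point needs no slacks, so its model value contains no `θ k` and, up to
  -- the common term `f(x_k)`, is bounded; the optimal value contains at least `θ k` times the new
  -- violation.
  have hsub : P.SubFeasible (R.x k) (z - R.x k) 0 0 0 := by
    refine ⟨fun i => ?_, fun i => ?_, fun i => le_rfl, fun i => le_rfl, fun i => le_rfl⟩ <;>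
      rw [haff.lin_eq, add_sub_cancel]
    · simp [hz.1 i]
    · simpa using hz.2 i
  have h1 := (R.solves k).2 _ _ _ _ hsub
  have h2 := haff.violation_add_le (R.solves k).1
  have hd : ∀ y ∈ D, ‖y - R.x k‖ ≤ 2 * r := fun y hy =>
    (norm_sub_le _ _).trans (by linarith [hr y hy, hr _ (hxD k)])
  have hdk : ‖R.d k‖ ≤ 2 * r := by
    have := hd _ (hxD (k + 1))
    rwa [hstep, add_sub_cancel_left] at this
  have hdz := hd z (hΩD hz)
  have e1 : inner ℝ (R.g k) (z - R.x k) ≤ M * (2 * r) :=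
    (real_inner_le_norm _ _).trans (by gcongr; exact hM k)
  have e2 : -inner ℝ (R.g k) (R.d k) ≤ M * (2 * r) :=
    (neg_le_abs _).trans ((abs_real_inner_le_norm _ _).trans (by gcongr; exact hM k))
  have e3 : inner ℝ (z - R.x k) (R.B k (z - R.x k)) ≤ 2 * r * (β * (2 * r)) :=
    (real_inner_le_norm _ _).trans (by
      gcongr
      exact ((R.B k).le_opNorm _).trans (by gcongr; exact hβ k))
  have e4 := mul_le_mul_of_nonneg_left h2 (R.θ_pos k).le
  have e5 := hB0 k (R.d k)
  simp only [subObjective, Pi.zero_apply, add_zero, Finset.sum_const_zero, mul_zero] at h1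
  rw [hstep]
  linarith

end SQPRun

/-- Under MFCQ the only nonnegative combination of active gradients that vanishes is trivial. -/
theorem MFCQ.eq_zero_of_sum_eq_zero {x : EuclideanSpace ℝ (Fin n)} (h : P.MFCQ x)
    {lam : Fin me ⊕ Fin mi → ℝ} (hlam : ∀ i, 0 ≤ lam (Sum.inr i))
    (hact : ∀ i, lam (Sum.inr i) ≠ 0 → P.c (Sum.inr i) x = 0)
    (hsum : ∑ i, lam i • gradient (P.c i) x = 0) : lam = 0 := by
  obtain ⟨hli, u, hu, hu'⟩ := h
  rw [Fintype.sum_sum_type] at hsum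
  have hI : ∀ i, lam (Sum.inr i) = 0 := by
    -- Pairing with the MFCQ direction kills the equality part and leaves a sum of nonnegative
    -- terms.
    have h1 := congrArg (fun y => inner ℝ y u) hsum
    simp only [inner_add_left, sum_inner, real_inner_smul_left, hu', mul_zero,
      Finset.sum_const_zero, zero_add, inner_zero_left] at h1
    have hnn : ∀ i, 0 ≤ lam (Sum.inr i) * inner ℝ (gradient (P.c (Sum.inr i)) x) u := by
      intro i
      by_cases h0 : lam (Sum.inr i) = 0
      · simp [h0]
      · exact mul_nonneg (hlam i) (hu i (hact i h0)).le
    intro i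
    by_contra h0
    have h2 := (Finset.sum_eq_zero_iff_of_nonneg fun i _ => hnn i).1 h1 i (Finset.mem_univ i)
    exact (mul_pos ((hlam i).lt_of_ne' h0) (hu i (hact i h0))).ne' h2
  simp only [hI, zero_smul, Finset.sum_const_zero, add_zero] at hsum
  have hE := Fintype.linearIndependent_iff.1 hli _ hsum
  funext i
  rcases i with i | i
  · exact hE i
  · exact hI i

/-! ### Boundedness of the penalty parameters and eventual feasibility -/

namespace SQPRun

variable {η τ γ : ℝ} {R : P.SQPRun η τ γ} {D : Set (EuclideanSpace ℝ (Fin n))}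

/-- The penalty parameters are bounded. -/
theorem bddAbove_θ (haff : P.AffineConstraints) (hne : P.feasible.Nonempty)
    (hΩD : P.feasible ⊆ D) (hD : IsCompact D) (hxD : ∀ k, R.x k ∈ D)
    (hstep : ∀ k, R.x (k + 1) = R.x k + R.d k) {M β : ℝ}
    (hM : ∀ k, ‖R.g k‖ ≤ M) (hβ : ∀ k, ‖R.B k‖ ≤ β) (hB0 : ∀ k y, 0 ≤ inner ℝ y (R.B k y))
    (hMFCQ : ∀ xbar, MapClusterPt xbar atTop R.x → P.MFCQ xbar) :
    BddAbove (Set.range R.θ) := by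
  by_contra hunb
  have hθtop : Tendsto R.θ atTop atTop := tendsto_atTop_atTop_of_monotone' R.θ_mono hunb
  -- Otherwise the update would eventually keep `θ k`, making it constant. Along the indices found
  -- here the multiplier norms tend to infinity.
  have hfreq : ∃ᶠ k in atTop, R.θ k ≤ ‖R.lam (k + 1)‖ + γ := by
    by_contra hnot
    rw [not_frequently] at hnot
    obtain ⟨N, hN⟩ := eventually_atTop.1 hnot
    have hconst : ∀ m, R.θ (N + m) = R.θ N := by
      intro m
      induction m with
      | zero => rfl
      | succ m ih =>
        rw [← add_assoc, R.penalty, max_eq_left (not_le.1 (hN (N + m) (by omega))).le, ih]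
    refine hunb ⟨R.θ N, ?_⟩
    rintro _ ⟨k, rfl⟩
    exact (R.θ_mono (Nat.le_add_left k N)).trans (hconst k).le
  have hnb : (atTop ⊓ 𝓟 {k | R.θ k ≤ ‖R.lam (k + 1)‖ + γ}).NeBot :=
    frequently_mem_iff_neBot.1 hfreq
  set F : Ultrafilter ℕ := Ultrafilter.of (atTop ⊓ 𝓟 {k | R.θ k ≤ ‖R.lam (k + 1)‖ + γ})
  have hFle : (F : Filter ℕ) ≤ atTop := (Ultrafilter.of_le _).trans inf_le_left
  have hFmem : ∀ᶠ k in (F : Filter ℕ), R.θ k ≤ ‖R.lam (k + 1)‖ + γ :=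
    (Ultrafilter.of_le _).trans inf_le_right (mem_principal_self _)
  have hnorm : Tendsto (fun k => ‖R.lam (k + 1)‖) F atTop := by
    refine tendsto_atTop_mono' _ ?_
      (tendsto_atTop_add_const_right (F : Filter ℕ) (-γ) (hθtop.mono_left hFle))
    exact hFmem.mono fun k hk => by linarith
  have hinv : Tendsto (fun k => ‖R.lam (k + 1)‖⁻¹) F (𝓝 0) := tendsto_inv_atTop_zero.comp hnorm
  obtain ⟨xbar, -, hxbar⟩ := hD.exists_tendsto_ultrafilter F fun k => hxD (k + 1)
  obtain ⟨lbar, -, hlbar⟩ := (isCompact_closedBall (0 : Fin me ⊕ Fin mi → ℝ) 1).exists_tendsto_ultrafilter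
    F (u := fun k => ‖R.lam (k + 1)‖⁻¹ • R.lam (k + 1)) fun k => by
      rw [mem_closedBall_zero_iff, norm_smul, norm_inv, norm_norm]
      exact inv_mul_le_one
  have hcl : MapClusterPt xbar atTop R.x := by
    have : Tendsto (fun k : ℕ => k + 1) F atTop := (tendsto_add_atTop_nat 1).mono_left hFle
    exact MapClusterPt.of_comp this hxbar.mapClusterPt
  obtain ⟨a, ha, hc⟩ := haff.exists_normals
  have hl1 : ‖lbar‖ = 1 := by
    refine tendsto_nhds_unique hlbar.norm (tendsto_const_nhds.congr' ?_)
    filter_upwards [hnorm.eventually_gt_atTop 0] with k hk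
    rw [norm_smul, norm_inv, norm_norm, inv_mul_cancel₀ hk.ne']
  have hcomp : ∀ i, Tendsto (fun k => ‖R.lam (k + 1)‖⁻¹ * R.lam (k + 1) i) F (𝓝 (lbar i)) :=
    fun i => (tendsto_pi_nhds.1 hlbar) i
  obtain ⟨r, hr⟩ := hD.isBounded.exists_norm_le
  have hr0 : 0 ≤ r := (norm_nonneg _).trans (hr _ (hxD 0))
  have hβ0 : 0 ≤ β := (norm_nonneg _).trans (hβ 0)
  -- Stationarity divided by the multiplier norm: `g + B d` stays bounded.
  have hsum : ∑ i, lbar i • gradient (P.c i) xbar = 0 := by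
    have h1 : Tendsto (fun k => ∑ i, (‖R.lam (k + 1)‖⁻¹ * R.lam (k + 1) i) • a i) F
        (𝓝 (∑ i, lbar i • gradient (P.c i) xbar)) := by
      simp only [ha]
      exact tendsto_finsetSum _ fun i _ => (hcomp i).smul_const _
    refine tendsto_nhds_unique h1 ?_
    have h2 : ∀ k, ∑ i, (‖R.lam (k + 1)‖⁻¹ * R.lam (k + 1) i) • a i
        = ‖R.lam (k + 1)‖⁻¹ • (R.g k + R.B k (R.d k)) := by
      intro k
      have h3 := sub_eq_zero.1 (R.multiplier k).1
      simp only [ha] at h3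
      rw [h3, Finset.smul_sum]
      exact Finset.sum_congr rfl fun i _ => mul_smul _ _ _
    simp only [h2]
    have h4 : ∀ k, ‖R.g k + R.B k (R.d k)‖ ≤ M + β * (2 * r) := by
      intro k
      refine (norm_add_le _ _).trans (add_le_add (hM k) (((R.B k).le_opNorm _).trans ?_))
      have h5 : ‖R.d k‖ ≤ 2 * r := by
        have h6 : R.d k = R.x (k + 1) - R.x k := by rw [hstep, add_sub_cancel_left]
        rw [h6]
        exact (norm_sub_le _ _).trans (by linarith [hr _ (hxD k), hr _ (hxD (k + 1))])
      gcongr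
      exact hβ k
    refine squeeze_zero_norm (a := fun k => ‖R.lam (k + 1)‖⁻¹ * (M + β * (2 * r))) (fun k => ?_)
      (by simpa using hinv.mul_const (M + β * (2 * r)))
    rw [norm_smul, norm_inv, norm_norm]
    gcongr
    exact h4 k
  obtain ⟨C, hC⟩ := exists_mul_violation_le haff hne hΩD hD hxD hstep hM hβ hB0
  have hvio : Tendsto (fun k => P.violation (R.x (k + 1))) F (𝓝 0) := by
    refine squeeze_zero (g := fun k => C * (R.θ k)⁻¹) (fun k => violation_nonneg _) (fun k => ?_) ?_
    · rw [← div_eq_mul_inv, le_div_iff₀ (R.θ_pos k), mul_comm]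
      exact hC k
    · simpa using (tendsto_inv_atTop_zero.comp (hθtop.mono_left hFle)).const_mul C
  have hci : ∀ i, Tendsto (fun k => P.c i (R.x (k + 1))) F (𝓝 (P.c i xbar)) := fun i =>
    ((haff.continuous i).tendsto xbar).comp hxbar
  have hzero : lbar = 0 := by
    refine (hMFCQ xbar hcl).eq_zero_of_sum_eq_zero (fun i => ?_) (fun i hi => ?_) hsum
    · exact ge_of_tendsto (hcomp (Sum.inr i)) (Eventually.of_forall fun k =>
        mul_nonneg (by positivity) ((R.multiplier k).2.2.2.1 i))
    · have h1 : 0 ≤ P.c (Sum.inr i) xbar :=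
        le_of_tendsto_of_tendsto (by simpa using hvio.neg) (hci _)
          (Eventually.of_forall fun k => by
            have := neg_ineq_le_violation (P := P) (R.x (k + 1)) i
            simp only
            linarith)
      -- A nonzero limit makes the multipliers nonzero nearby, and complementarity then gives
      -- `c_i(x_{k+1}) = -t_i ≤ 0`.
      refine le_antisymm (le_of_tendsto (hci _) ?_) h1
      filter_upwards [(hcomp (Sum.inr i)).eventually_ne hi] with k hk
      have h2 := (R.multiplier k).2.2.1 i
      rw [haff.lin_eq, ← hstep] at h2
      have h3 := (mul_eq_zero.1 h2).resolve_left fun h0 => hk (by rw [h0, mul_zero])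
      have h4 := (R.multiplier k).2.1.2.2.2.2 i
      linarith
  rw [hzero, norm_zero] at hl1
  exact zero_ne_one hl1

/-- Eventually the iterates are feasible, with bounded complementary multipliers. -/
theorem exists_forall_feasible (haff : P.AffineConstraints) (hγ : 0 < γ)
    (hstep : ∀ k, R.x (k + 1) = R.x k + R.d k) (hbdd : BddAbove (Set.range R.θ)) :
    ∃ (N : ℕ) (S : ℝ), ∀ k ≥ N, R.x (k + 1) ∈ P.feasible ∧ ‖R.lam (k + 1)‖ ≤ S ∧
      ∀ i, R.lam (k + 1) (Sum.inr i) * P.c (Sum.inr i) (R.x (k + 1)) = 0 := by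
  -- Once `θ N` is within `γ` of the supremum, the update rule forces later multipliers strictly
  -- below the penalty.
  obtain ⟨N, hN⟩ := exists_lt_of_lt_ciSup (sub_lt_self (⨆ k, R.θ k) hγ)
  refine ⟨N, ⨆ k, R.θ k, fun k hk => ?_⟩
  have h1 : ‖R.lam (k + 1)‖ + γ ≤ ⨆ k, R.θ k := by
    refine le_trans ?_ (le_ciSup hbdd (k + 1))
    rw [R.penalty]
    exact le_max_right _ _
  have h2 : ‖R.lam (k + 1)‖ < R.θ k := by linarith [R.θ_mono hk]
  obtain ⟨h3, h4⟩ := (R.multiplier k).feasible_of_norm_lt haff h2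
  rw [hstep]
  exact ⟨h3, by linarith, h4⟩

end SQPRun

end NLP

/-! ## The potential function along the iteration -/

namespace NLP

variable {n me mi : ℕ} {P : NLP n me mi} {D : Set (EuclideanSpace ℝ (Fin n))} {σ l : ℝ}

theorem conjugateFun_bigF_ge {x : EuclideanSpace ℝ (Fin n)} (hx : x ∈ D)
    (y : EuclideanSpace ℝ (Fin n)) :
    ((inner ℝ y x - (-P.f x + 1 / 2 * σ * ‖x‖ ^ 2) : ℝ) : EReal)
      ≤ conjugateFun (P.bigF σ D) y := by
  refine le_trans (le_of_eq ?_) (le_iSup (fun x => ((inner ℝ y x : ℝ) : EReal) - P.bigF σ D x) x)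
  simp only [bigF, if_pos hx, EReal.coe_sub]

/-- The majorant of `f` says exactly that `σ • x - g` is a subgradient of `F` at `x`; this is the
equality case of Fenchel–Young. -/
theorem HasClarkeMajorants.conjugateFun_bigF_eq (hmaj : P.HasClarkeMajorants D σ)
    {x g : EuclideanSpace ℝ (Fin n)} (hx : x ∈ D) (hg : g ∈ clarkeSubdiff P.f x) :
    conjugateFun (P.bigF σ D) (σ • x - g)
      = ((inner ℝ (σ • x - g) x - (-P.f x + 1 / 2 * σ * ‖x‖ ^ 2) : ℝ) : EReal) := by
  refine le_antisymm (iSup_le fun u => ?_) (conjugateFun_bigF_ge hx _)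
  by_cases hu : u ∈ D
  · simp only [bigF, if_pos hu, ← EReal.coe_sub, EReal.coe_le_coe_iff]
    have h1 := hmaj x hx u hu g hg
    rw [norm_sub_sq_real, real_inner_comm x u] at h1
    simp only [inner_sub_left, inner_sub_right, real_inner_smul_left,
      real_inner_self_eq_norm_sq] at h1 ⊢
    linarith
  · simp [bigF, if_neg hu]

/-- Replacing `F*` by its affine minorant from a single `x` gives an explicit lower bound, so no
further knowledge of `F*` is needed to verify subgradients. -/
theorem potential_ge (haff : P.AffineConstraints) {x : EuclideanSpace ℝ (Fin n)} (hx : x ∈ D)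
    (z : PiLp 2 (fun _ : Fin 3 => EuclideanSpace ℝ (Fin n))) {r : ℝ}
    (hr : z 0 ∈ P.feasible → r ≤ -inner ℝ (z 1) (z 0) +
      (inner ℝ (z 1) x - (-P.f x + 1 / 2 * σ * ‖x‖ ^ 2)) +
      (1 / 2 * σ * ‖z 0‖ ^ 2 + 1 / 2 * l * ‖z 0 - z 2‖ ^ 2)) :
    (r : EReal) ≤ P.potential σ l D z := by
  have hconj := conjugateFun_bigF_ge (P := P) (σ := σ) hx (z 1)
  by_cases hz : z 0 ∈ P.feasible
  · rw [potential, indicatorFun, if_pos (haff.mem_linFeasible.2 hz), add_zero]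
    refine (EReal.coe_le_coe_iff.2 (hr hz)).trans ?_
    rw [EReal.coe_add, EReal.coe_add]
    gcongr
  · rw [potential, indicatorFun, if_neg fun h => hz (haff.mem_linFeasible.1 h),
      EReal.add_top_of_ne_bot]
    · exact le_top
    -- In `EReal` the value `⊥` would absorb the `⊤` of the indicator.
    · have h1 := ne_bot_of_le_ne_bot (EReal.coe_ne_bot _) hconj
      simp only [ne_eq, EReal.add_eq_bot_iff, h1, EReal.coe_ne_bot, or_self, not_false_eq_true]

theorem HasClarkeMajorants.potential_eq (hmaj : P.HasClarkeMajorants D σ)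
    (haff : P.AffineConstraints) {x g u w : EuclideanSpace ℝ (Fin n)} (hx : x ∈ D)
    (hg : g ∈ clarkeSubdiff P.f x) (hu : u ∈ P.feasible) :
    P.potential σ l D (WithLp.toLp 2 ![u, σ • x - g, w])
      = ((P.f x + inner ℝ g (u - x) + σ / 2 * ‖u - x‖ ^ 2 + l / 2 * ‖u - w‖ ^ 2 : ℝ) : EReal) := by
  rw [potential, indicatorFun, if_pos (haff.mem_linFeasible.2 (by simpa using hu)), add_zero]
  simp only [Matrix.cons_val]
  rw [hmaj.conjugateFun_bigF_eq hx hg, ← EReal.coe_add, ← EReal.coe_add, EReal.coe_eq_coe_iff,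
    norm_sub_sq_real u x, real_inner_comm x u]
  simp only [inner_sub_left, inner_sub_right, real_inner_smul_left, real_inner_self_eq_norm_sq]
  ring

/-- An explicit regular subgradient of the potential function. -/
theorem HasClarkeMajorants.mem_regularSubdiff_potential (hmaj : P.HasClarkeMajorants D σ)
    (haff : P.AffineConstraints) (hσ : 0 ≤ σ) (hl : 0 ≤ l)
    {x g u w s : EuclideanSpace ℝ (Fin n)} (hx : x ∈ D)
    (hg : g ∈ clarkeSubdiff P.f x) (hu : u ∈ P.feasible)
    (hs : ∀ u' ∈ P.feasible, 0 ≤ inner ℝ s (u' - u)) :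
    WithLp.toLp 2 ![-(σ • x - g) + σ • u + l • (u - w) - s, x - u, -(l • (u - w))]
      ∈ regularSubdiff (P.potential σ l D) (WithLp.toLp 2 ![u, σ • x - g, w]) := by
  have heq := hmaj.potential_eq (l := l) (w := w) haff hx hg hu
  refine ⟨by rw [heq]; exact EReal.coe_ne_top _, by rw [heq]; exact EReal.coe_ne_bot _,
    fun ε hε => ?_⟩
  filter_upwards [Metric.ball_mem_nhds _ hε] with z hz
  rw [heq, ← EReal.coe_add]
  refine potential_ge haff hx z fun hzf => ?_
  have h1 := hs _ hzf
  set y := σ • x - g with hy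
  set Δ := z - WithLp.toLp 2 ![u, y, w] with hΔ
  have hΔε : ‖Δ‖ ≤ ε := (mem_ball_iff_norm.1 hz).le
  obtain ⟨a, ha⟩ : ∃ a, a = z 0 - u := ⟨_, rfl⟩
  obtain ⟨c, hc⟩ : ∃ c, c = z 1 - y := ⟨_, rfl⟩
  obtain ⟨e, he⟩ : ∃ e, e = z 2 - w := ⟨_, rfl⟩
  have ha' : Δ 0 = a := by simp [hΔ, ha]
  have hc' : Δ 1 = c := by simp [hΔ, hc]
  have he' : Δ 2 = e := by simp [hΔ, he]
  have hz0 : z 0 = u + a := by rw [ha]; abel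
  have hz1 : z 1 = y + c := by rw [hc]; abel
  have hz2 : z 2 = w + e := by rw [he]; abel
  have hnorm : ‖Δ‖ ^ 2 = ‖a‖ ^ 2 + ‖c‖ ^ 2 + ‖e‖ ^ 2 := by
    rw [PiLp.norm_sq_eq_of_L2, Fin.sum_univ_three, ha', hc', he']
  -- The bilinear term `-yᵀx` leaves the only remainder of unknown sign, `-⟪c, a⟫`; on the ball of
  -- radius `ε` it is absorbed by the error `ε‖Δ‖`.
  have hsmall : ‖Δ‖ ^ 2 ≤ ε * ‖Δ‖ := by
    rw [sq]
    gcongr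
  have hac : inner ℝ c a ≤ ‖Δ‖ ^ 2 := by
    have := real_inner_le_norm c a
    nlinarith [sq_nonneg (‖c‖ - ‖a‖), sq_nonneg ‖c‖, sq_nonneg ‖a‖, sq_nonneg ‖e‖]
  have hinner : ∀ p₀ p₁ p₂ : EuclideanSpace ℝ (Fin n), inner ℝ (WithLp.toLp 2 ![p₀, p₁, p₂]) Δ
      = inner ℝ p₀ a + inner ℝ p₁ c + inner ℝ p₂ e := fun p₀ p₁ p₂ => by
    rw [PiLp.inner_apply, Fin.sum_univ_three, ha', hc', he']
    simp only [Matrix.cons_val]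
  rw [hinner, hz0, hz1, hz2]
  rw [hz0, add_sub_cancel_left] at h1
  have e1 : u + a - (w + e) = (u - w) + (a - e) := by abel
  have e2 : g = σ • x - y := by rw [hy]; abel
  have hpos1 : 0 ≤ 1 / 2 * σ * ‖a‖ ^ 2 := by positivity
  have hpos2 : 0 ≤ 1 / 2 * l * ‖a - e‖ ^ 2 := by positivity
  rw [e1, norm_add_sq_real (u - w), norm_add_sq_real u, e2, norm_sub_sq_real u x]
  simp only [inner_add_left, inner_add_right, inner_sub_left, inner_sub_right,
    inner_neg_left, real_inner_smul_left, real_inner_self_eq_norm_sq]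
  rw [real_inner_comm x u, real_inner_comm c x, real_inner_comm c u]
  linarith

end NLP

/-! ## Convergence of the iterates -/

theorem EuclideanSpace.norm_toLp_three_le {n : ℕ} (a b c : EuclideanSpace ℝ (Fin n)) :
    ‖(WithLp.toLp 2 ![a, b, c] : PiLp 2 (fun _ : Fin 3 => EuclideanSpace ℝ (Fin n)))‖
      ≤ ‖a‖ + ‖b‖ + ‖c‖ := by
  refine le_of_sq_le_sq ?_ (by positivity)
  rw [PiLp.norm_sq_eq_of_L2, Fin.sum_univ_three]
  simp only [Matrix.cons_val]
  nlinarith [norm_nonneg a, norm_nonneg b, norm_nonneg c, mul_nonneg (norm_nonneg a) (norm_nonneg b),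
    mul_nonneg (norm_nonneg a) (norm_nonneg c), mul_nonneg (norm_nonneg b) (norm_nonneg c)]

namespace NLP.SQPRun

variable {n me mi : ℕ} {P : NLP n me mi} {η τ γ : ℝ} {R : P.SQPRun η τ γ}
  {D O : Set (EuclideanSpace ℝ (Fin n))}

/-- Once the iterates are feasible, the KL property makes the run have finite length. -/
theorem summable_norm_d (haff : P.AffineConstraints) (hO : IsOpen O) (hDO : D ⊆ O)
    (hf : ContinuousOn P.f O) (hΩD : P.feasible ⊆ D) (hD : IsCompact D) (hxD : ∀ k, R.x k ∈ D)
    (hstep : ∀ k, R.x (k + 1) = R.x k + R.d k) {M β b σ l : ℝ}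
    (hmaj : P.HasClarkeMajorants D σ) (hσ : 0 ≤ σ) (hl : 0 < l)
    (hM : ∀ k, ‖R.g k‖ ≤ M) (hβ : ∀ k, ‖R.B k‖ ≤ β)
    (hBb : ∀ k y, b * ‖y‖ ^ 2 ≤ inner ℝ y (R.B k y)) (hbl : σ + l ≤ 2 * b)
    (hKL : IsKLFunction (P.potential σ l D)) {m : ℕ}
    (hfeas : ∀ j, R.x (m + j) ∈ P.feasible)
    (hcomp : ∀ j i, R.lam (m + j + 1) (Sum.inr i) * P.c (Sum.inr i) (R.x (m + j + 1)) = 0) :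
    Summable fun j => ‖R.d (m + j)‖ := by
  have hβ0 : 0 ≤ β := (norm_nonneg _).trans (hβ 0)
  obtain ⟨r, hr⟩ := hD.isBounded.exists_norm_le
  set z : ℕ → PiLp 2 (fun _ : Fin 3 => EuclideanSpace ℝ (Fin n)) := fun j =>
    WithLp.toLp 2 ![R.x (m + j + 1), σ • R.x (m + j) - R.g (m + j), R.x (m + j)] with hz
  set s : ℕ → ℝ := fun j => P.f (R.x (m + j)) + inner ℝ (R.g (m + j)) (R.d (m + j))
    + σ / 2 * ‖R.d (m + j)‖ ^ 2 + l / 2 * ‖R.d (m + j)‖ ^ 2 with hs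
  have hL : ∀ j, P.potential σ l D (z j) = s j := by
    intro j
    have h1 := hmaj.potential_eq (l := l) (w := R.x (m + j)) haff (hxD (m + j))
      (R.subgrad (m + j)) (hfeas (j + 1))
    rw [show m + (j + 1) = m + j + 1 by ring, hstep (m + j), add_sub_cancel_left] at h1
    rw [hz, hs]
    simp only [hstep (m + j)]
    exact h1
  have hflow : ∀ j, P.f (R.x (m + j + 1)) ≤ P.f (R.x (m + j)) + inner ℝ (R.g (m + j)) (R.d (m + j))
      + σ / 2 * ‖R.d (m + j)‖ ^ 2 := by
    intro j
    have := hmaj _ (hxD (m + j)) _ (hxD (m + j + 1)) _ (R.subgrad (m + j))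
    rwa [show R.x (m + j + 1) - R.x (m + j) = R.d (m + j) by
      rw [hstep (m + j), add_sub_cancel_left]] at this
  -- The value `f(x_{k+1})` separates the two: `2b ≥ σ + l` puts `s (j + 1)` below it, and the
  -- majorant puts `s j` above it by `(l/2)‖d_k‖²`.
  have hdesc : ∀ j, s (j + 1) ≤ s j - l / 2 * ‖R.d (m + j)‖ ^ 2 := by
    intro j
    have h1 := (R.multiplier (m + j + 1)).inner_add_le haff (R.θ_pos _).le
    have h2 : P.violation (R.x (m + j + 1)) = 0 := violation_eq_zero (hfeas (j + 1))
    have h3 : P.violation (R.x (m + j + 1) + R.d (m + j + 1)) = 0 := by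
      rw [← hstep]
      exact violation_eq_zero (hfeas (j + 2))
    rw [h2, h3, sub_zero, mul_zero] at h1
    have h4 := hBb (m + j + 1) (R.d (m + j + 1))
    have h5 := hflow j
    have h6 := mul_le_mul_of_nonneg_right hbl (sq_nonneg ‖R.d (m + j + 1)‖)
    simp only [hs, show m + (j + 1) = m + j + 1 by ring]
    linarith
  have hanti : Antitone s := antitone_nat_of_succ_le fun j =>
    (hdesc j).trans (sub_le_self _ (by positivity))
  obtain ⟨q, hq⟩ := (hD.image_of_continuousOn (hf.mono hDO)).bddBelow
  have hbdd : BddBelow (Set.range s) := by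
    refine ⟨q, ?_⟩
    rintro _ ⟨j, rfl⟩
    have h1 : q ≤ P.f (R.x (m + j + 1)) := hq ⟨_, hxD _, rfl⟩
    have h2 : 0 ≤ l / 2 * ‖R.d (m + j)‖ ^ 2 := by positivity
    have h3 := hflow j
    simp only [hs]
    linarith
  have hslim := tendsto_atTop_ciInf hanti hbdd
  have hdlim : Tendsto (fun j => R.d (m + j)) atTop (𝓝 0) := by
    have h1 : Tendsto (fun j => 2 / l * (s j - s (j + 1))) atTop (𝓝 0) := by
      simpa using (hslim.sub (hslim.comp (tendsto_add_atTop_nat 1))).const_mul (2 / l)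
    have h2 : Tendsto (fun j => ‖R.d (m + j)‖ ^ 2) atTop (𝓝 0) := by
      refine squeeze_zero (fun j => by positivity) (fun j => ?_) h1
      have h3 := mul_le_mul_of_nonneg_left (hdesc j) (show 0 ≤ 2 / l by positivity)
      have h4 : 2 / l * (l / 2 * ‖R.d (m + j)‖ ^ 2) = ‖R.d (m + j)‖ ^ 2 := by field_simp
      linarith
    rw [tendsto_zero_iff_norm_tendsto_zero]
    simpa using h2.sqrt
  have hsub : ∀ j, ∃ h ∈ regularSubdiff (P.potential σ l D) (z j),
      ‖h‖ ≤ (σ + 2 * l + β + 1) * ‖R.d (m + j)‖ := by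
    intro j
    -- The choice `s = g + B d = ∑ λ_i ∇c_i` has the required sign on the feasible set by
    -- complementarity, and it cancels `g` in the first component.
    have hmem := hmaj.mem_regularSubdiff_potential haff hσ hl.le (w := R.x (m + j))
      (s := R.g (m + j) + R.B (m + j) (R.d (m + j))) (hxD (m + j)) (R.subgrad (m + j))
      (hfeas (j + 1)) (fun u' hu' => by
        obtain ⟨a, ha, hc⟩ := haff.exists_normals
        rw [sub_eq_zero.1 (R.multiplier (m + j)).1, sum_inner]
        refine Finset.sum_nonneg fun i _ => ?_
        rw [ha, real_inner_smul_left]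
        have h1 := hc i (R.x (m + (j + 1))) u'
        rw [show inner ℝ (a i) (u' - R.x (m + (j + 1))) = P.c i u' - P.c i (R.x (m + j + 1)) by
          rw [h1, add_assoc]
          simp]
        rcases i with i | i
        · have h2 : P.c (Sum.inl i) (R.x (m + j + 1)) = 0 := (hfeas (j + 1)).1 i
          rw [hu'.1 i, h2, sub_zero, mul_zero]
        · rw [mul_sub, hcomp, sub_zero]
          exact mul_nonneg ((R.multiplier (m + j)).2.2.2.1 i) (hu'.2 i))
    refine ⟨_, hmem, (EuclideanSpace.norm_toLp_three_le _ _ _).trans ?_⟩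
    have hx : R.x (m + (j + 1)) = R.x (m + j) + R.d (m + j) := hstep (m + j)
    have e1 : -(σ • R.x (m + j) - R.g (m + j)) + σ • R.x (m + (j + 1))
        + l • (R.x (m + (j + 1)) - R.x (m + j)) - (R.g (m + j) + R.B (m + j) (R.d (m + j)))
        = (σ + l) • R.d (m + j) - R.B (m + j) (R.d (m + j)) := by
      rw [hx]
      module
    have e2 : R.x (m + j) - R.x (m + (j + 1)) = -R.d (m + j) := by rw [hx]; abel
    have e3 : R.x (m + (j + 1)) - R.x (m + j) = R.d (m + j) := by rw [hx]; abel
    rw [e1, e2, e3, norm_neg, norm_neg, norm_smul, Real.norm_eq_abs, abs_of_pos hl]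
    have h1 : ‖(σ + l) • R.d (m + j)‖ = (σ + l) * ‖R.d (m + j)‖ := by
      rw [norm_smul, Real.norm_eq_abs, abs_of_nonneg (by linarith)]
    have h2 : ‖R.B (m + j) (R.d (m + j))‖ ≤ β * ‖R.d (m + j)‖ :=
      ((R.B (m + j)).le_opNorm _).trans (by gcongr; exact hβ _)
    have h3 := norm_sub_le ((σ + l) • R.d (m + j)) (R.B (m + j) (R.d (m + j)))
    linarith
  have hzK : ∀ j, z j ∈ Metric.closedBall 0 (r + (σ * r + M) + r) := by
    intro j
    rw [mem_closedBall_zero_iff]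
    refine (EuclideanSpace.norm_toLp_three_le _ _ _).trans ?_
    have h1 : ‖σ • R.x (m + j) - R.g (m + j)‖ ≤ σ * r + M := by
      refine (norm_sub_le _ _).trans (add_le_add ?_ (hM _))
      rw [norm_smul, Real.norm_eq_abs, abs_of_nonneg hσ]
      gcongr
      exact hr _ (hxD _)
    linarith [hr _ (hxD (m + j)), hr _ (hxD (m + j + 1))]
  have hproper : ProperSpace (PiLp 2 (fun _ : Fin 3 => EuclideanSpace ℝ (Fin n))) :=
    FiniteDimensional.proper_real _
  refine summable_of_hasKLAt (L := P.potential σ l D) (isCompact_closedBall _ _) hzK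
    (fun zbar hcl => ?_) hL hslim (half_pos hl) (C := σ + 2 * l + β + 1) (by positivity)
    (fun j => norm_nonneg _) hdesc fun j => ?_
  · obtain ⟨ψ, hψ, hzψ⟩ := hcl.tendsto_subseq
    have hψ' := hψ.tendsto_atTop
    have hdψ : Tendsto (fun j => R.d (m + ψ j)) atTop (𝓝 0) := hdlim.comp hψ'
    have hcoord : ∀ i, Tendsto (fun j => z (ψ j) i) atTop (𝓝 (zbar i)) := fun i =>
      ((PiLp.continuous_apply 2 _ i).tendsto zbar).comp hzψ
    have hx : Tendsto (fun j => R.x (m + ψ j)) atTop (𝓝 (zbar 2)) := by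
      simpa [hz] using hcoord 2
    have hx' : Tendsto (fun j => R.x (m + ψ j + 1)) atTop (𝓝 (zbar 0)) := by
      simpa [hz] using hcoord 0
    have h02 : zbar 0 = zbar 2 := by
      refine tendsto_nhds_unique hx' ?_
      simpa [hstep] using hx.add hdψ
    have hg : Tendsto (fun j => R.g (m + ψ j)) atTop (𝓝 (σ • zbar 2 - zbar 1)) := by
      have h1 : Tendsto (fun j => σ • R.x (m + ψ j) - R.g (m + ψ j)) atTop (𝓝 (zbar 1)) := by
        simpa [hz] using hcoord 1
      simpa using (hx.const_smul σ).sub h1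
    have hbarF : zbar 2 ∈ P.feasible :=
      haff.isClosed_feasible.mem_of_tendsto hx (Eventually.of_forall fun j => hfeas _)
    have hbarg := mem_clarkeSubdiff_of_tendsto hx hg fun j => R.subgrad (m + ψ j)
    have hbarz : zbar
        = WithLp.toLp 2 ![zbar 2, σ • zbar 2 - (σ • zbar 2 - zbar 1), zbar 2] := by
      ext1 i
      fin_cases i <;> simp [h02]
    have hLbar : P.potential σ l D zbar = P.f (zbar 2) := by
      have h1 := hmaj.potential_eq (l := l) (w := zbar 2) haff (hΩD hbarF) hbarg hbarF
      rw [← hbarz] at h1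
      simpa using h1
    have hsψ : Tendsto (s ∘ ψ) atTop (𝓝 (P.f (zbar 2))) := by
      have hfat := (hf.continuousAt (hO.mem_nhds (hDO (hΩD hbarF)))).tendsto.comp hx
      simpa [hs, Function.comp_def] using ((hfat.add (hg.inner hdψ)).add ((hdψ.norm.pow 2).const_mul (σ / 2))).add
        ((hdψ.norm.pow 2).const_mul (l / 2))
    have hsbar := tendsto_nhds_unique hsψ (hslim.comp hψ')
    choose h hreg hnorm using hsub
    -- The small regular subgradients at `z (ψ j)` make `0` a limiting subgradient at the cluster
    -- point, where the KL property therefore applies.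
    refine ⟨hKL zbar ⟨0, by rw [hLbar]; exact EReal.coe_ne_top _,
      by rw [hLbar]; exact EReal.coe_ne_bot _, z ∘ ψ, h ∘ ψ, hzψ, ?_, fun j => hreg _, ?_⟩,
      by rw [hLbar, hsbar]⟩
    · simp only [Function.comp_apply, hL, hLbar]
      exact (continuous_coe_real_ereal.tendsto _).comp hsψ
    · exact squeeze_zero_norm (fun j => hnorm (ψ j))
        (by simpa using hdψ.norm.const_mul (σ + 2 * l + β + 1))
  · obtain ⟨h, hh, hn⟩ := hsub j
    exact ⟨h, regularSubdiff_subset_generalSubdiff _ _ hh, hn⟩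

/-- Limits of the iterates are KKT points. -/
theorem isKKT_of_tendsto (haff : P.AffineConstraints) (hstep : ∀ k, R.x (k + 1) = R.x k + R.d k)
    {M β S : ℝ} (hM : ∀ k, ‖R.g k‖ ≤ M) (hβ : ∀ k, ‖R.B k‖ ≤ β) {m : ℕ}
    (hfeas : ∀ j, R.x (m + j + 1) ∈ P.feasible) (hS : ∀ j, ‖R.lam (m + j + 1)‖ ≤ S)
    (hcomp : ∀ j i, R.lam (m + j + 1) (Sum.inr i) * P.c (Sum.inr i) (R.x (m + j + 1)) = 0)
    {xbar : EuclideanSpace ℝ (Fin n)} (hx : Tendsto R.x atTop (𝓝 xbar)) : P.IsKKT xbar := by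
  have hFle : (hyperfilter ℕ : Filter ℕ) ≤ atTop := Nat.hyperfilter_le_atTop
  have hxj : Tendsto (fun j => R.x (m + j)) (hyperfilter ℕ) (𝓝 xbar) :=
    (hx.comp (tendsto_add_atTop_nat m)).mono_left hFle |>.congr fun j => by simp [add_comm]
  have hxj' : Tendsto (fun j => R.x (m + j + 1)) (hyperfilter ℕ) (𝓝 xbar) :=
    (hx.comp (tendsto_add_atTop_nat (m + 1))).mono_left hFle |>.congr fun j => by
      simp only [Function.comp_apply]
      congr 1
      ring
  have hd : Tendsto (fun j => R.d (m + j)) (hyperfilter ℕ) (𝓝 0) := by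
    simpa [hstep] using hxj'.sub hxj
  obtain ⟨g, -, hg⟩ := (isCompact_closedBall (0 : EuclideanSpace ℝ (Fin n)) M).exists_tendsto_ultrafilter
    (hyperfilter ℕ) (u := fun j => R.g (m + j)) fun j => mem_closedBall_zero_iff.2 (hM _)
  obtain ⟨lam, -, hlam⟩ := (isCompact_closedBall (0 : Fin me ⊕ Fin mi → ℝ) S).exists_tendsto_ultrafilter
    (hyperfilter ℕ) (u := fun j => R.lam (m + j + 1)) fun j => mem_closedBall_zero_iff.2 (hS _)
  have hlami : ∀ i, Tendsto (fun j => R.lam (m + j + 1) i) (hyperfilter ℕ) (𝓝 (lam i)) :=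
    tendsto_pi_nhds.1 hlam
  have hci : ∀ i, Tendsto (fun j => P.c i (R.x (m + j + 1))) (hyperfilter ℕ) (𝓝 (P.c i xbar)) :=
    fun i => ((haff.continuous i).tendsto xbar).comp hxj'
  have hBd : Tendsto (fun j => R.B (m + j) (R.d (m + j))) (hyperfilter ℕ) (𝓝 0) :=
    squeeze_zero_norm (fun j => ((R.B (m + j)).le_opNorm _).trans
      (mul_le_mul_of_nonneg_right (hβ _) (norm_nonneg _))) (by simpa using hd.norm.const_mul β)
  have hbar : xbar ∈ P.feasible :=
    haff.isClosed_feasible.mem_of_tendsto hxj' (Eventually.of_forall hfeas)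
  obtain ⟨a, ha, -⟩ := haff.exists_normals
  refine ⟨lam, ⟨g, mem_clarkeSubdiff_of_tendsto hxj hg fun j => R.subgrad _, ?_⟩, hbar.1,
    fun i => ?_, hbar.2, fun i => ?_⟩
  · have h1 : Tendsto (fun j => R.g (m + j) + R.B (m + j) (R.d (m + j))
        - ∑ i, R.lam (m + j + 1) i • a i) (hyperfilter ℕ) (𝓝 (g + 0 - ∑ i, lam i • a i)) :=
      (hg.add hBd).sub (tendsto_finsetSum _ fun i _ => (hlami i).smul_const _)
    have h2 : ∀ j, R.g (m + j) + R.B (m + j) (R.d (m + j)) - ∑ i, R.lam (m + j + 1) i • a i = 0 :=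
      fun j => by simpa only [ha] using (R.multiplier (m + j)).1
    simp only [h2, add_zero] at h1
    simp only [ha]
    exact (tendsto_nhds_unique tendsto_const_nhds h1).symm
  · have h1 := (hlami (Sum.inr i)).mul (hci (Sum.inr i))
    simp only [hcomp] at h1
    exact (tendsto_nhds_unique tendsto_const_nhds h1).symm
  · exact ge_of_tendsto (hlami _) (Eventually.of_forall fun j => (R.multiplier (m + j)).2.2.2.1 i)

end NLP.SQPRun

theorem mainTheorem3 {n me mi : ℕ} (P : NLP n me mi)
    -- the objective is upper-C² on an open set containing the compact convex set D,
    -- Lipschitz on D, and ρ is a constant of its convexity modification on D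
    (O D : Set (EuclideanSpace ℝ (Fin n))) (hO : IsOpen O) (hDO : D ⊆ O)
    (hDcompact : IsCompact D) (hDconvex : Convex ℝ D)
    (hLip : ∃ K, LipschitzOnWith K P.f D) (hupper : IsUpperC2On P.f O)
    (ρ : ℝ) (hρ : 0 < ρ)
    (hρconv : ConvexOn ℝ D (fun x => -P.f x + 1 / 2 * ρ * ‖x‖ ^ 2))
    -- affine constraints, nonempty feasible region contained in D
    (haff : P.AffineConstraints) (hne : P.feasible.Nonempty) (hΩD : P.feasible ⊆ D)
    -- a run of the algorithm; initial point and subproblem solutions stay in D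
    (η τ γ : ℝ) (hη : 0 < η) (hη' : η < 1) (hτ : 0 < τ) (hτ' : τ < 1) (hγ : 0 < γ)
    (R : P.SQPRun η τ γ)
    (hx0 : R.x 0 ∈ D) (htrial : ∀ k, R.x k + R.d k ∈ D)
    -- the matrices B k are bounded and uniformly positive definite with constant b
    (hBbdd : ∃ β : ℝ, ∀ k, ‖R.B k‖ ≤ β)
    (b : ℝ) (hb : 0 < b) (hBb : ∀ k y, b * ‖y‖ ^ 2 ≤ inner ℝ y (R.B k y))
    -- MFCQ at all accumulation points of the iterates
    (hMFCQ : ∀ xbar, MapClusterPt xbar atTop R.x → P.MFCQ xbar)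
    -- the potential function is a KL function
    (σ l : ℝ) (hl : 0 < l) (hKL : IsKLFunction (P.potential σ l D))
    (hbσ : σ ≤ b) (hσρ : ρ ≤ σ) (hbl : σ + l ≤ 2 * b) :
    ∃ xbar, Tendsto R.x atTop (𝓝 xbar) ∧ P.IsKKT xbar := by
  obtain ⟨β, hβ⟩ := hBbdd
  have hσ : 0 ≤ σ := hρ.le.trans hσρ
  have hmaj : P.HasClarkeMajorants D σ := fun x hx y hy g hg => by
    have h1 := hupper.le_of_mem_clarkeSubdiff hDO hρconv hx hy hg
    have h2 : ρ / 2 * ‖y - x‖ ^ 2 ≤ σ / 2 * ‖y - x‖ ^ 2 := by gcongr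
    linarith
  have hrun := R.mem_and_step_eq haff hmaj hη' hx0 htrial hb.le hBb hbσ
  have hxD := fun k => (hrun k).1
  have hstep := fun k => (hrun k).2
  obtain ⟨M, -, hM⟩ := hupper.exists_norm_clarkeSubdiff_le hDcompact hDO
  have hg : ∀ k, ‖R.g k‖ ≤ M := fun k => hM _ (hxD k) _ (R.subgrad k)
  have hB0 : ∀ k y, 0 ≤ inner ℝ y (R.B k y) := fun k y => le_trans (by positivity) (hBb k y)
  have hbdd := R.bddAbove_θ haff hne hΩD hDcompact hxD hstep hg hβ hB0 hMFCQ
  obtain ⟨N, S, hN⟩ := R.exists_forall_feasible haff hγ hstep hbdd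
  -- Feasibility is known for `x (k + 1)` with `k ≥ N`, hence the start at `N + 1`.
  have hsum := R.summable_norm_d (m := N + 1) haff hO hDO hupper.continuousOn hΩD hDcompact hxD
    hstep hmaj hσ hl hg hβ hBb hbl hKL
    (fun j => by simpa [add_right_comm] using (hN (N + j) (Nat.le_add_right _ _)).1)
    (fun j => (hN (N + 1 + j) (by omega)).2.2)
  have hcauchy : CauchySeq fun j => R.x (N + 1 + j) := by
    refine cauchySeq_of_dist_le_of_summable _ (fun j => ?_) hsum
    have h1 : R.x (N + 1 + (j + 1)) = R.x (N + 1 + j) + R.d (N + 1 + j) := hstep (N + 1 + j)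
    rw [h1, dist_self_add_right]
  obtain ⟨xbar, hxbar⟩ := cauchySeq_tendsto_of_complete hcauchy
  have hx : Tendsto R.x atTop (𝓝 xbar) := by
    rw [← tendsto_add_atTop_iff_nat (N + 1)]
    exact hxbar.congr fun j => by rw [add_comm]
  exact ⟨xbar, hx, R.isKKT_of_tendsto (m := N) haff hstep hg hβ
    (fun j => (hN _ (Nat.le_add_right _ _)).1) (fun j => (hN _ (Nat.le_add_right _ _)).2.1)
    (fun j => (hN _ (Nat.le_add_right _ _)).2.2) hx⟩
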